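/- Let $\tau\in(0,1)$, $\rho_\tau(u)=\tfrac12u^2\,|\tau-I(u<0)|$, and fix a number of batches $b\ge 1$. At each stage of the asymptotics one observes batches $t=1,\dots,b$ of sizes $n_t$, consisting of observations $(\boldsymbol x_{ti},y_{ti})\in\mathbb R^p\times\mathbb R$, $1\le i\le n_t$, all of them i.i.d. with a law that does not depend on the stage. Put $N_t=n_1+\dots+n_t$, $\epsilon_{ti}=y_{ti}-\boldsymbol x_{ti}^\top\boldsymbol\beta_0$, and assume, with positive constants $c_1,\dots,c_4$: (C1) $\boldsymbol\beta_0$ lies in the interior of a compact convex set $\mathcal H\subset\mathbb R^p$. (C2) Given $\boldsymbol x_{ti}=\boldsymbol x$, the conditional $\tau$-expectile of $\epsilon_{ti}$, i.e. $\arg\min_\theta \mathbb E[\rho_\tau(\epsilon_{ti}-\theta)\mid \boldsymbol x]$, is $0$, and $\mathbb E[\epsilon_{ti}^2\mid \boldsymbol x]\le c_1$. (C3) $\boldsymbol\Sigma=\mathbb E[\boldsymbol x_{ti}\boldsymbol x_{ti}^\top]$ satisfies $0<\lambda_{\min}(\boldsymbol\Sigma)\le\lambda_{\max}(\boldsymbol\Sigma)\le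 c_2$. (C4) Given $\boldsymbol x_{ti}=\boldsymbol x$, $\epsilon_{ti}$ has a density $f$ with $0<f\le c_3$. (C5) $n_1\to\infty$ (the sizes $n_2,\dots,n_b$ may vary arbitrarily with the stage), and $\|\boldsymbol x_{ti}\|<c_4$. Let $\mathcal L_{n_t}(\boldsymbol\beta)=\frac1{n_t}\sum_{i=1}^{n_t}\rho_\tau(y_{ti}-\boldsymbol x_{ti}^\top\boldsymbol\beta)$ and $W_{n_t}(\boldsymbol\beta)=\sum_{i=1}^{n_t}|\tau-I(y_{ti}<\boldsymbol x_{ti}^\top\boldsymbol\beta)|\,\boldsymbol x_{ti}\boldsymbol x_{ti}^\top$. The oracle estimator $\hat{\boldsymbol\beta}^\star_b$ is a minimizer over $\mathbb R^p$ of $\frac1{N_b}\sum_{t=1}^b n_t\mathcal L_{n_t}(\boldsymbol\beta)$. The renewable estimators are defined recursively: $\tilde{\boldsymbol\beta}_1$ minimizes $\mathcal L_{n_1}$, and for $t\ge2$, $\tilde{\boldsymbol\beta}_t$ minimizes $$\frac1{N_t}\Big\{\tfrac12(\boldsymbol\beta-\tilde{\boldsymbol\beta}_{t-1})^\top\Big[\sum_{s=1}^{t-1}W_{n_s}(\tilde{\boldsymbol\beta}_s)\Big](\boldsymbol\beta-\tilde{\boldsymbol\beta}_{t-1})+n_t\mathcal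 L_{n_t}(\boldsymbol\beta)\Big\}.$$ Then $$\|\tilde{\boldsymbol\beta}_b-\hat{\boldsymbol\beta}^\star_b\|=O_p(1/N_b),$$ where $\|\cdot\|$ is the Euclidean norm: for every $\varepsilon>0$ there is $M>0$ such that $\mathbb P\big(\|\tilde{\boldsymbol\beta}_b-\hat{\boldsymbol\beta}^\star_b\|>M/N_b\big)\le\varepsilon$ at all sufficiently late stages. -/

import Mathlib

open MeasureTheory ProbabilityTheory Filter Topology
open scoped Matrix

namespace ReER

noncomputable section

/-- The asymmetric weight `|τ - I(u < 0)|`. -/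
def weight (τ u : ℝ) : ℝ := |τ - (if u < 0 then 1 else 0)|

/-- The asymmetric squared loss `ρ_τ(u) = (1/2) u² |τ - I(u < 0)|`. -/
def rho (τ u : ℝ) : ℝ := 1 / 2 * u ^ 2 * |τ - (if u < 0 then 1 else 0)|

/-- `θ` is a `τ`-expectile of the law `m` on the real line: a minimizer of
`θ ↦ E ρ_τ(U - θ)`, where `U` has law `m`. It is used for laws with a finite second moment. -/
def IsExpectile (τ : ℝ) (m : Measure ℝ) (θ : ℝ) : Prop :=
  IsMinOn (fun s : ℝ => ∫ u, rho τ (u - s) ∂m) Set.univ θ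

variable {p : ℕ}

/-- The matrix `E[x xᵀ]` of a covariate vector `x` with law `π`. -/
def secondMoment (π : Measure (EuclideanSpace ℝ (Fin p))) : Matrix (Fin p) (Fin p) ℝ :=
  Matrix.of fun i j => ∫ v, v i * v j ∂π

/-- The loss of one batch of `n` observations,
`L_n(β) = (1/n) ∑_{i=1}^n ρ_τ(y_i - x_iᵀ β)`. -/
def batchLoss (τ : ℝ) (n : ℕ) (x : ℕ → EuclideanSpace ℝ (Fin p)) (y : ℕ → ℝ)
    (β : EuclideanSpace ℝ (Fin p)) : ℝ :=
  1 / (n : ℝ) * ∑ i ∈ Finset.Icc 1 n, rho τ (y i - inner ℝ (x i) β)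

/-- `W_n(β) = ∑_{i=1}^n |τ - I(y_i < x_iᵀ β)| x_i x_iᵀ`, that is, `n` times the Hessian
of the batch loss at `β`; where some `y_i = x_iᵀ β` and the second derivative jumps, the formula
fixes its value. -/
def batchHessian (τ : ℝ) (n : ℕ) (x : ℕ → EuclideanSpace ℝ (Fin p)) (y : ℕ → ℝ)
    (β : EuclideanSpace ℝ (Fin p)) : Matrix (Fin p) (Fin p) ℝ :=
  ∑ i ∈ Finset.Icc 1 n,
    weight τ (y i - inner ℝ (x i) β) • Matrix.vecMulVec (x i).ofLp (x i).ofLp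

/-- The cumulative sample size `N_b = n_1 + ⋯ + n_b`. -/
def totalSize (n : ℕ → ℕ) (b : ℕ) : ℕ := ∑ t ∈ Finset.Icc 1 b, n t

/-- The loss of all the data up to batch `b`, `(1/N_b) ∑_{t=1}^b n_t L_{n_t}(β)`. -/
def fullLoss (τ : ℝ) (n : ℕ → ℕ) (x : ℕ → ℕ → EuclideanSpace ℝ (Fin p)) (y : ℕ → ℕ → ℝ)
    (b : ℕ) (β : EuclideanSpace ℝ (Fin p)) : ℝ :=
  1 / (totalSize n b : ℝ) *
    ∑ t ∈ Finset.Icc 1 b, (n t : ℝ) * batchLoss τ (n t) (x t) (y t) β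

/-- The cumulative Hessian `∑_{t=1}^b W_{n_t}(β_t)` along a path `β_1, β_2, …`. -/
def cumHessian (τ : ℝ) (n : ℕ → ℕ) (x : ℕ → ℕ → EuclideanSpace ℝ (Fin p)) (y : ℕ → ℕ → ℝ)
    (path : ℕ → EuclideanSpace ℝ (Fin p)) (b : ℕ) : Matrix (Fin p) (Fin p) ℝ :=
  ∑ t ∈ Finset.Icc 1 b, batchHessian τ (n t) (x t) (y t) (path t)

/-- The online loss at batch `b`: the losses of the earlier batches are replaced by the quadratic
form of the cumulative Hessian around the previous estimate `β_{b-1}`,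
`(1/N_b) { (1/2) (β - β_{b-1})ᵀ [∑_{t<b} W_{n_t}(β_t)] (β - β_{b-1}) + n_b L_{n_b}(β) }`. -/
def onlineLoss (τ : ℝ) (n : ℕ → ℕ) (x : ℕ → ℕ → EuclideanSpace ℝ (Fin p)) (y : ℕ → ℕ → ℝ)
    (path : ℕ → EuclideanSpace ℝ (Fin p)) (b : ℕ) (β : EuclideanSpace ℝ (Fin p)) : ℝ :=
  1 / (totalSize n b : ℝ) *
    (1 / 2 * ((β - path (b - 1)).ofLp ⬝ᵥ
        (cumHessian τ n x y path (b - 1) *ᵥ (β - path (b - 1)).ofLp))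
      + (n b : ℝ) * batchLoss τ (n b) (x b) (y b) β)

/-- `β` is an oracle estimate based on all the data up to batch `b`. -/
def IsOracle (τ : ℝ) (n : ℕ → ℕ) (x : ℕ → ℕ → EuclideanSpace ℝ (Fin p)) (y : ℕ → ℕ → ℝ)
    (b : ℕ) (β : EuclideanSpace ℝ (Fin p)) : Prop :=
  IsMinOn (fullLoss τ n x y b) Set.univ β

/-- `path 1, …, path b` are renewable estimates: the first one minimizes the loss of the first
batch and each later one minimizes the online loss built from the earlier ones. -/
structure IsRenewable (τ : ℝ) (n : ℕ → ℕ) (x : ℕ → ℕ → EuclideanSpace ℝ (Fin p))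
    (y : ℕ → ℕ → ℝ) (b : ℕ) (path : ℕ → EuclideanSpace ℝ (Fin p)) : Prop where
  init : IsMinOn (batchLoss τ (n 1) (x 1) (y 1)) Set.univ (path 1)
  step : ∀ t, 2 ≤ t → t ≤ b → IsMinOn (onlineLoss τ n x y path t) Set.univ (path t)

/-- `Z_k = O_p(a_k)` as `k → ∞`: for every `ε > 0` there is `M` such that eventually
`|Z_k| ≤ M a_k` outside a set of probability at most `ε`. -/
def IsBigOp {Ω : Type*} [MeasurableSpace Ω] (P : Measure Ω) (Z : ℕ → Ω → ℝ) (a : ℕ → ℝ) : Prop :=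
  ∀ ε : ℝ, 0 < ε → ∃ M : ℝ, 0 < M ∧
    ∀ᶠ k in atTop, P {ω | M * a k < |Z k ω|} ≤ ENNReal.ofReal ε

end

end ReER

namespace ReER

/-! The loss `ρ_τ` is piecewise quadratic with its only kink in the second derivative at 0, so its
derivative, the score, is exactly linear on either side of 0. A quadratic surrogate of an old batch
is therefore wrong only through observations whose residual may change sign along the path of
estimates, and these are few.

Let g_s be the gradient of n_s L_{n_s} and G_t = ∑_{s ≤ t} g_s(β_t), the full gradient at the
renewable estimate. The first-order condition of step t + 1 makes G_{t+1} - G_t equal to the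
linearization error of ∑_{s ≤ t} g_s between β_t and β_{t+1}, the slopes being the weights frozen at
β_s. If all β_s are within R/√N_s of β₀, an observation of batch s contributes only when |ε| ≤
cR/√N_s. A bounded density leaves O_p(n_s/√N_s) = O_p(√N_s) of those, and each contributes at most a
multiple of ‖β_{t+1} - β_t‖ = O(1/√N_t). Hence every increment is O_p(1), and so is G_b
(`IsRenewable.norm_sum_batchGrad_le`). The full gradient vanishes at the oracle estimate and is
strongly monotone with modulus of order N_b, which gives the rate 1/N_b
(`IsRenewable.norm_sub_oracle_le`).

The square root rate is an induction on t (`IsRenewable.norm_sub_mul_sqrt_le`): frozen curvature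
plus the new gradient is strongly monotone with modulus of order N_t, while the earlier error and
the score at β₀ perturb it by only O(√N_t). Global strong convexity makes a preliminary consistency
argument unnecessary.

All this is deterministic on an event where the batch scores at β₀ are O(√n_t), the pooled designs
are nondegenerate and small errors are few. Chebyshev's inequality gives the first two, Markov's the
third. -/

/-- The derivative `|τ - I(u < 0)| u` of the asymmetric squared loss. -/
noncomputable def score (τ u : ℝ) : ℝ := weight τ u * u

/-! ### Scalar inequalities for the loss and its score -/

lemma weight_eq_ite {τ : ℝ} (hτ : τ ∈ Set.Ioo (0 : ℝ) 1) (u : ℝ) :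
    weight τ u = if u < 0 then 1 - τ else τ := by
  obtain ⟨h0, h1⟩ := hτ
  unfold weight
  split_ifs
  · rw [abs_sub_comm, abs_of_pos (by linarith)]
  · rw [sub_zero, abs_of_pos h0]

lemma weight_le_one {τ : ℝ} (hτ : τ ∈ Set.Ioo (0 : ℝ) 1) (u : ℝ) : weight τ u ≤ 1 := by
  rw [weight_eq_ite hτ]
  split_ifs <;> linarith [hτ.1, hτ.2]

lemma min_le_weight {τ : ℝ} (hτ : τ ∈ Set.Ioo (0 : ℝ) 1) (u : ℝ) :
    min τ (1 - τ) ≤ weight τ u := by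
  rw [weight_eq_ite hτ]
  split_ifs
  · exact min_le_right _ _
  · exact min_le_left _ _

lemma min_pos_of_mem {τ : ℝ} (hτ : τ ∈ Set.Ioo (0 : ℝ) 1) : 0 < min τ (1 - τ) :=
  lt_min hτ.1 (by linarith [hτ.2])

lemma weight_nonneg (τ u : ℝ) : 0 ≤ weight τ u := abs_nonneg _

lemma rho_eq (τ u : ℝ) : rho τ u = 1 / 2 * weight τ u * u ^ 2 := by
  unfold rho weight; ring

lemma measurable_weight (τ : ℝ) : Measurable (weight τ) := by
  have h : Measurable fun u : ℝ => τ - (if u < 0 then (1 : ℝ) else 0) :=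
    measurable_const.sub (Measurable.ite measurableSet_Iio measurable_const measurable_const)
  exact h.norm

lemma measurable_rho (τ : ℝ) : Measurable (rho τ) := by
  have : rho τ = fun u => 1 / 2 * weight τ u * u ^ 2 := funext (rho_eq τ)
  rw [this]
  exact ((measurable_weight τ).const_mul _).mul (measurable_id.pow_const 2)

lemma measurable_score (τ : ℝ) : Measurable (score τ) :=
  (measurable_weight τ).mul measurable_id

/-- The second derivative is the weight, at most 1, and the score is continuous at the kink, so the
second-order upper expansion is global. It is all that the first-order conditions need. -/
lemma rho_add_le {τ : ℝ} (hτ : τ ∈ Set.Ioo (0 : ℝ) 1) (u h : ℝ) :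
    rho τ (u + h) ≤ rho τ u + score τ u * h + 1 / 2 * h ^ 2 := by
  rw [rho_eq, rho_eq, score, weight_eq_ite hτ, weight_eq_ite hτ]
  obtain ⟨h0, h1⟩ := hτ
  have h2 : 0 < 1 - τ := by linarith
  split_ifs with ha hb hb
  · nlinarith [mul_nonneg h0.le (sq_nonneg h)]
  · push Not at hb
    nlinarith [mul_nonneg h0.le (sq_nonneg (u + h)), mul_nonneg hb (neg_pos.2 ha).le,
      mul_nonneg h2.le (mul_nonneg hb (neg_pos.2 ha).le),
      mul_nonneg h2.le (sq_nonneg u)]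
  · push Not at ha
    nlinarith [mul_nonneg h2.le (sq_nonneg (u + h)), mul_nonneg ha (neg_pos.2 hb).le,
      mul_nonneg h0.le (mul_nonneg ha (neg_pos.2 hb).le),
      mul_nonneg h0.le (sq_nonneg u)]
  · nlinarith [mul_nonneg h2.le (sq_nonneg h)]

/-- The score is continuous and piecewise linear with slopes `τ` and `1 - τ`, so no secant slope is
below the smaller one. This is the source of all strong monotonicity below. -/
lemma min_mul_sq_le_score_sub_mul {τ : ℝ} (hτ : τ ∈ Set.Ioo (0 : ℝ) 1) (u v : ℝ) :
    min τ (1 - τ) * (u - v) ^ 2 ≤ (score τ u - score τ v) * (u - v) := by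
  have hl := min_le_left τ (1 - τ)
  have hr := min_le_right τ (1 - τ)
  rw [score, score, weight_eq_ite hτ, weight_eq_ite hτ]
  generalize min τ (1 - τ) = m at *
  split_ifs with ha hb hb
  · nlinarith [mul_nonneg (sub_nonneg.2 hr) (sq_nonneg (u - v))]
  · push Not at hb
    have h1 : 0 ≤ v - u := by linarith
    nlinarith [mul_nonneg (mul_nonneg (sub_nonneg.2 hr) (neg_pos.2 ha).le) h1,
      mul_nonneg (mul_nonneg (sub_nonneg.2 hl) hb) h1]
  · push Not at ha
    have h1 : 0 ≤ u - v := by linarith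
    nlinarith [mul_nonneg (mul_nonneg (sub_nonneg.2 hr) (neg_pos.2 hb).le) h1,
      mul_nonneg (mul_nonneg (sub_nonneg.2 hl) ha) h1]
  · nlinarith [mul_nonneg (sub_nonneg.2 hl) (sq_nonneg (u - v))]

lemma abs_score_sub_le {τ : ℝ} (hτ : τ ∈ Set.Ioo (0 : ℝ) 1) (u v : ℝ) :
    |score τ u - score τ v| ≤ |u - v| := by
  rw [score, score, weight_eq_ite hτ, weight_eq_ite hτ]
  obtain ⟨h0, h1⟩ := hτ
  split_ifs with ha hb hb
  · rw [← mul_sub, abs_mul, abs_of_pos (by linarith : (0 : ℝ) < 1 - τ)]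
    nlinarith [abs_nonneg (u - v)]
  · push Not at hb
    rw [abs_of_nonpos (by linarith : u - v ≤ 0), abs_le]
    constructor <;> nlinarith
  · push Not at ha
    rw [abs_of_nonneg (by linarith : 0 ≤ u - v), abs_le]
    constructor <;> nlinarith
  · rw [← mul_sub, abs_mul, abs_of_pos h0]
    nlinarith [abs_nonneg (u - v)]

lemma abs_score_le {τ : ℝ} (hτ : τ ∈ Set.Ioo (0 : ℝ) 1) (u : ℝ) : |score τ u| ≤ |u| := by
  rw [score, abs_mul, abs_of_nonneg (weight_nonneg _ _)]
  exact mul_le_of_le_one_left (abs_nonneg _) (weight_le_one hτ u)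

/-- The linearization error of the score vanishes unless the residual is small. -/
lemma abs_score_linearization_le {τ : ℝ} (hτ : τ ∈ Set.Ioo (0 : ℝ) 1) {e a a' a'' r : ℝ}
    (ha : |a| ≤ r) (ha' : |a'| ≤ r) (ha'' : |a''| ≤ r) :
    |score τ (e - a') - score τ (e - a) + weight τ (e - a'') * (a' - a)|
      ≤ 2 * |a' - a| * (if |e| ≤ r then 1 else 0) := by
  split_ifs with he
  · have h1 := abs_score_sub_le hτ (e - a') (e - a)
    have h2 : |weight τ (e - a'') * (a' - a)| ≤ |a' - a| := by
      rw [abs_mul, abs_of_nonneg (weight_nonneg _ _)]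
      exact mul_le_of_le_one_left (abs_nonneg _) (weight_le_one hτ _)
    have h3 : |e - a' - (e - a)| = |a' - a| := by
      rw [abs_sub_comm]; congr 1; ring
    linarith [abs_add_le (score τ (e - a') - score τ (e - a)) (weight τ (e - a'') * (a' - a))]
  · push Not at he
    rw [abs_le] at ha ha' ha''
    have : score τ (e - a') - score τ (e - a) + weight τ (e - a'') * (a' - a) = 0 := by
      simp only [score, weight_eq_ite hτ]
      -- Beyond r all three shifted residuals have the sign of e, so the weights agree and the score
      -- is linear there. The third point a'' is free because a batch's weights are frozen at an
      -- earlier estimate.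
      rcases lt_abs.1 he with h | h
      · rw [if_neg (by linarith), if_neg (by linarith), if_neg (by linarith)]; ring
      · rw [if_pos (by linarith), if_pos (by linarith), if_pos (by linarith)]; ring
    simp [this]

/-- First-order condition for a function with a quadratic upper expansion at its minimizer. -/
lemma eq_zero_of_isMinOn_of_le_quadratic {E : Type*} [NormedAddCommGroup E]
    [InnerProductSpace ℝ E] {F : E → ℝ} {β g : E} {C : ℝ} (hmin : IsMinOn F Set.univ β)
    (hF : ∀ h, F (β + h) ≤ F β + inner ℝ g h + C * ‖h‖ ^ 2) : g = 0 := by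
  by_contra hg
  have hg' : 0 < ‖g‖ ^ 2 := by positivity
  set s : ℝ := 1 / (2 * (|C| + 1)) with hs
  have hs0 : 0 < s := by positivity
  have hCs : C * s ≤ 1 / 2 := by
    rw [hs, mul_one_div, div_le_div_iff₀ (by positivity) two_pos]
    nlinarith [le_abs_self C]
  have h1 := hF (-s • g)
  have h2 : F β ≤ F (β + -s • g) := hmin (Set.mem_univ _)
  rw [inner_smul_right, real_inner_self_eq_norm_sq, norm_smul, Real.norm_eq_abs, abs_neg,
    abs_of_pos hs0, mul_pow] at h1
  have h3 : 0 < s * ‖g‖ ^ 2 := by positivity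
  nlinarith

/-! ### First-order conditions of the oracle and renewable estimates -/

section batch

variable {p : ℕ}

/-- The gradient of `n` times the batch loss. -/
noncomputable def batchGrad (τ : ℝ) (n : ℕ) (x : ℕ → EuclideanSpace ℝ (Fin p)) (y : ℕ → ℝ)
    (β : EuclideanSpace ℝ (Fin p)) : EuclideanSpace ℝ (Fin p) :=
  -∑ i ∈ Finset.Icc 1 n, score τ (y i - inner ℝ (x i) β) • x i

/-- The action of the cumulative Hessian on a vector. -/
noncomputable def cumCurv (τ : ℝ) (n : ℕ → ℕ) (x : ℕ → ℕ → EuclideanSpace ℝ (Fin p))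
    (y : ℕ → ℕ → ℝ) (path : ℕ → EuclideanSpace ℝ (Fin p)) (t : ℕ)
    (v : EuclideanSpace ℝ (Fin p)) : EuclideanSpace ℝ (Fin p) :=
  ∑ s ∈ Finset.Icc 1 t, ∑ i ∈ Finset.Icc 1 (n s),
    (weight τ (y s i - inner ℝ (x s i) (path s)) * inner ℝ (x s i) v) • x s i

/-- For n = 0 the sum is empty and 1/0 = 0, so no positivity is required and later batches may be
empty. -/
lemma mul_batchLoss (τ : ℝ) (n : ℕ) (x : ℕ → EuclideanSpace ℝ (Fin p)) (y : ℕ → ℝ)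
    (β : EuclideanSpace ℝ (Fin p)) :
    (n : ℝ) * batchLoss τ n x y β = ∑ i ∈ Finset.Icc 1 n, rho τ (y i - inner ℝ (x i) β) := by
  rcases Nat.eq_zero_or_pos n with rfl | hn
  · simp
  · have : (n : ℝ) ≠ 0 := by positivity
    unfold batchLoss
    field_simp

lemma sum_rho_add_le {τ : ℝ} (hτ : τ ∈ Set.Ioo (0 : ℝ) 1) (n : ℕ)
    (x : ℕ → EuclideanSpace ℝ (Fin p)) (y : ℕ → ℝ) (β h : EuclideanSpace ℝ (Fin p)) :
    ∑ i ∈ Finset.Icc 1 n, rho τ (y i - inner ℝ (x i) (β + h)) ≤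
      ∑ i ∈ Finset.Icc 1 n, rho τ (y i - inner ℝ (x i) β) + inner ℝ (batchGrad τ n x y β) h
        + (1 / 2 * ∑ i ∈ Finset.Icc 1 n, ‖x i‖ ^ 2) * ‖h‖ ^ 2 := by
  rw [batchGrad, inner_neg_left, sum_inner, Finset.mul_sum, Finset.sum_mul,
    ← Finset.sum_neg_distrib, ← Finset.sum_add_distrib, ← Finset.sum_add_distrib]
  refine Finset.sum_le_sum fun i _ => ?_
  have h1 := rho_add_le hτ (y i - inner ℝ (x i) β) (-inner ℝ (x i) h)
  have h2 : y i - inner ℝ (x i) (β + h) = y i - inner ℝ (x i) β + -inner ℝ (x i) h := by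
    rw [inner_add_right]; ring
  have h3 : (inner ℝ (x i) h) ^ 2 ≤ ‖x i‖ ^ 2 * ‖h‖ ^ 2 := by
    rw [← mul_pow, sq_le_sq, abs_of_nonneg (by positivity : 0 ≤ ‖x i‖ * ‖h‖)]
    exact abs_real_inner_le_norm _ _
  rw [h2, real_inner_smul_left]
  nlinarith

lemma inner_cumCurv (τ : ℝ) (n : ℕ → ℕ) (x : ℕ → ℕ → EuclideanSpace ℝ (Fin p))
    (y : ℕ → ℕ → ℝ) (path : ℕ → EuclideanSpace ℝ (Fin p)) (t : ℕ)
    (u v : EuclideanSpace ℝ (Fin p)) :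
    inner ℝ (cumCurv τ n x y path t u) v =
      ∑ s ∈ Finset.Icc 1 t, ∑ i ∈ Finset.Icc 1 (n s),
        weight τ (y s i - inner ℝ (x s i) (path s)) * (inner ℝ (x s i) u * inner ℝ (x s i) v) := by
  simp only [cumCurv, sum_inner, real_inner_smul_left, mul_assoc]

lemma dotProduct_cumHessian_mulVec (τ : ℝ) (n : ℕ → ℕ) (x : ℕ → ℕ → EuclideanSpace ℝ (Fin p))
    (y : ℕ → ℕ → ℝ) (path : ℕ → EuclideanSpace ℝ (Fin p)) (t : ℕ)
    (v : EuclideanSpace ℝ (Fin p)) :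
    v.ofLp ⬝ᵥ (cumHessian τ n x y path t *ᵥ v.ofLp) =
      inner ℝ (cumCurv τ n x y path t v) v := by
  rw [inner_cumCurv]
  simp only [cumHessian, batchHessian, Matrix.sum_mulVec, dotProduct_sum, Matrix.smul_mulVec,
    dotProduct_smul, Matrix.vecMulVec_mulVec, smul_eq_mul]
  refine Finset.sum_congr rfl fun s _ => Finset.sum_congr rfl fun i _ => ?_
  have h1 : (x s i).ofLp ⬝ᵥ v.ofLp = inner ℝ (x s i) v := by
    rw [EuclideanSpace.inner_eq_star_dotProduct, dotProduct_comm]; simp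
  have h2 : v.ofLp ⬝ᵥ (x s i).ofLp = inner ℝ (x s i) v := by
    rw [EuclideanSpace.inner_eq_star_dotProduct]; simp
  simp only [h1, h2, MulOpposite.smul_eq_mul_unop, MulOpposite.unop_op]

lemma inner_cumCurv_add_self_le {τ : ℝ} (hτ : τ ∈ Set.Ioo (0 : ℝ) 1) (n : ℕ → ℕ)
    (x : ℕ → ℕ → EuclideanSpace ℝ (Fin p)) (y : ℕ → ℕ → ℝ)
    (path : ℕ → EuclideanSpace ℝ (Fin p)) (t : ℕ) (v h : EuclideanSpace ℝ (Fin p)) :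
    inner ℝ (cumCurv τ n x y path t (v + h)) (v + h) ≤
      inner ℝ (cumCurv τ n x y path t v) v + 2 * inner ℝ (cumCurv τ n x y path t v) h
        + (∑ s ∈ Finset.Icc 1 t, ∑ i ∈ Finset.Icc 1 (n s), ‖x s i‖ ^ 2) * ‖h‖ ^ 2 := by
  simp only [inner_cumCurv, Finset.mul_sum, Finset.sum_mul, ← Finset.sum_add_distrib]
  refine Finset.sum_le_sum fun s _ => Finset.sum_le_sum fun i _ => ?_
  have h3 : (inner ℝ (x s i) h) ^ 2 ≤ ‖x s i‖ ^ 2 * ‖h‖ ^ 2 := by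
    rw [← mul_pow, sq_le_sq, abs_of_nonneg (by positivity : 0 ≤ ‖x s i‖ * ‖h‖)]
    exact abs_real_inner_le_norm _ _
  have h4 := mul_le_of_le_one_left (sq_nonneg (inner ℝ (x s i) h))
    (weight_le_one hτ (y s i - inner ℝ (x s i) (path s)))
  rw [inner_add_right]
  nlinarith

lemma isMinOn_of_mul {α : Type*} {f g : α → ℝ} {c : ℝ} {a : α} (hc : 0 < c)
    (hfg : ∀ b, f b = c * g b) (hf : IsMinOn f Set.univ a) : IsMinOn g Set.univ a := by
  intro b _
  have h : f a ≤ f b := hf (Set.mem_univ b)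
  rw [hfg, hfg] at h
  exact le_of_mul_le_mul_left h hc

lemma totalSize_mono (n : ℕ → ℕ) : Monotone (totalSize n) := fun _ _ h =>
  Finset.sum_le_sum_of_subset (Finset.Icc_subset_Icc_right h)

lemma le_totalSize (n : ℕ → ℕ) {s t : ℕ} (hs : 1 ≤ s) (hst : s ≤ t) : n s ≤ totalSize n t :=
  Finset.single_le_sum (f := n) (fun _ _ => Nat.zero_le _) (Finset.mem_Icc.2 ⟨hs, hst⟩)

/-- First-order condition of the oracle estimator. -/
lemma IsOracle.sum_batchGrad_eq_zero {τ : ℝ} (hτ : τ ∈ Set.Ioo (0 : ℝ) 1) {n : ℕ → ℕ}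
    {x : ℕ → ℕ → EuclideanSpace ℝ (Fin p)} {y : ℕ → ℕ → ℝ} {b : ℕ}
    {β : EuclideanSpace ℝ (Fin p)} (hN : 0 < totalSize n b) (h : IsOracle τ n x y b β) :
    ∑ t ∈ Finset.Icc 1 b, batchGrad τ (n t) (x t) (y t) β = 0 := by
  have hmin : IsMinOn (fun β => ∑ t ∈ Finset.Icc 1 b,
      ∑ i ∈ Finset.Icc 1 (n t), rho τ (y t i - inner ℝ (x t i) β)) Set.univ β := by
    refine isMinOn_of_mul (c := 1 / (totalSize n b : ℝ)) (by positivity) (fun β => ?_) h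
    simp only [fullLoss, mul_batchLoss]
  refine eq_zero_of_isMinOn_of_le_quadratic hmin
    (C := ∑ t ∈ Finset.Icc 1 b, 1 / 2 * ∑ i ∈ Finset.Icc 1 (n t), ‖x t i‖ ^ 2) fun h => ?_
  rw [sum_inner, Finset.sum_mul, ← Finset.sum_add_distrib, ← Finset.sum_add_distrib]
  exact Finset.sum_le_sum fun t _ => sum_rho_add_le hτ _ _ _ _ _

/-- First-order condition of the renewable estimators. -/
lemma IsRenewable.cumCurv_add_batchGrad_eq_zero {τ : ℝ} (hτ : τ ∈ Set.Ioo (0 : ℝ) 1) {n : ℕ → ℕ}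
    {x : ℕ → ℕ → EuclideanSpace ℝ (Fin p)} {y : ℕ → ℕ → ℝ} {b : ℕ}
    {path : ℕ → EuclideanSpace ℝ (Fin p)} (hn : 0 < n 1) (h : IsRenewable τ n x y b path)
    {t : ℕ} (ht : 1 ≤ t) (htb : t ≤ b) :
    cumCurv τ n x y path (t - 1) (path t - path (t - 1)) +
      batchGrad τ (n t) (x t) (y t) (path t) = 0 := by
  have hmin : IsMinOn (fun β =>
      1 / 2 * inner ℝ (cumCurv τ n x y path (t - 1) (β - path (t - 1))) (β - path (t - 1))
      + ∑ i ∈ Finset.Icc 1 (n t), rho τ (y t i - inner ℝ (x t i) β)) Set.univ (path t) := by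
    -- At t = 1 the curvature is an empty sum, so the first batch obeys the same formula, whatever
    -- `path 0` is.
    rcases ht.eq_or_lt with rfl | ht2
    · refine isMinOn_of_mul (c := 1 / (n 1 : ℝ)) (by positivity) (fun β => ?_) h.init
      simp [cumCurv, batchLoss]
    · have hN : 0 < totalSize n t := hn.trans_le (le_totalSize n le_rfl ht)
      refine isMinOn_of_mul (c := 1 / (totalSize n t : ℝ)) (by positivity) (fun β => ?_)
        (h.step t ht2 htb)
      simp only [onlineLoss, mul_batchLoss, ← dotProduct_cumHessian_mulVec]
  refine eq_zero_of_isMinOn_of_le_quadratic hmin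
    (C := 1 / 2 * (∑ s ∈ Finset.Icc 1 (t - 1), ∑ i ∈ Finset.Icc 1 (n s), ‖x s i‖ ^ 2) +
      1 / 2 * ∑ i ∈ Finset.Icc 1 (n t), ‖x t i‖ ^ 2) fun h => ?_
  have h1 := sum_rho_add_le hτ (n t) (x t) (y t) (path t) h
  have h2 := inner_cumCurv_add_self_le hτ n x y path (t - 1) (path t - path (t - 1)) h
  rw [show path t + h - path (t - 1) = path t - path (t - 1) + h by abel, inner_add_left]
  linarith

end batch

/-! ### Deterministic error bounds on well-behaved data -/

section deterministic

variable {p : ℕ}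

lemma min_mul_sum_sq_le_inner_batchGrad_sub {τ : ℝ} (hτ : τ ∈ Set.Ioo (0 : ℝ) 1) (n : ℕ)
    (x : ℕ → EuclideanSpace ℝ (Fin p)) (y : ℕ → ℝ) (β β' : EuclideanSpace ℝ (Fin p)) :
    min τ (1 - τ) * ∑ i ∈ Finset.Icc 1 n, (inner ℝ (x i) (β - β')) ^ 2 ≤
      inner ℝ (batchGrad τ n x y β - batchGrad τ n x y β') (β - β') := by
  rw [batchGrad, batchGrad, ← Finset.sum_neg_distrib, ← Finset.sum_neg_distrib,
    ← Finset.sum_sub_distrib, sum_inner, Finset.mul_sum]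
  refine Finset.sum_le_sum fun i _ => ?_
  have h := min_mul_sq_le_score_sub_mul hτ (y i - inner ℝ (x i) β) (y i - inner ℝ (x i) β')
  rw [inner_sub_left, inner_neg_left, inner_neg_left, real_inner_smul_left, real_inner_smul_left,
    inner_sub_right]
  nlinarith

lemma min_mul_sum_sq_le_inner_cumCurv {τ : ℝ} (hτ : τ ∈ Set.Ioo (0 : ℝ) 1) (n : ℕ → ℕ)
    (x : ℕ → ℕ → EuclideanSpace ℝ (Fin p)) (y : ℕ → ℕ → ℝ)
    (path : ℕ → EuclideanSpace ℝ (Fin p)) (t : ℕ) (v : EuclideanSpace ℝ (Fin p)) :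
    min τ (1 - τ) * ∑ s ∈ Finset.Icc 1 t, ∑ i ∈ Finset.Icc 1 (n s), (inner ℝ (x s i) v) ^ 2 ≤
      inner ℝ (cumCurv τ n x y path t v) v := by
  simp only [inner_cumCurv, Finset.mul_sum, ← pow_two]
  exact Finset.sum_le_sum fun s _ => Finset.sum_le_sum fun i _ =>
    mul_le_mul_of_nonneg_right (min_le_weight hτ _) (sq_nonneg _)

lemma cumCurv_sub (τ : ℝ) (n : ℕ → ℕ) (x : ℕ → ℕ → EuclideanSpace ℝ (Fin p))
    (y : ℕ → ℕ → ℝ) (path : ℕ → EuclideanSpace ℝ (Fin p)) (t : ℕ)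
    (u v : EuclideanSpace ℝ (Fin p)) :
    cumCurv τ n x y path t (u - v) = cumCurv τ n x y path t u - cumCurv τ n x y path t v := by
  simp only [cumCurv, ← Finset.sum_sub_distrib, inner_sub_right, mul_sub, sub_smul]

lemma norm_cumCurv_le {τ : ℝ} (hτ : τ ∈ Set.Ioo (0 : ℝ) 1) {n : ℕ → ℕ}
    {x : ℕ → ℕ → EuclideanSpace ℝ (Fin p)} (y : ℕ → ℕ → ℝ)
    (path : ℕ → EuclideanSpace ℝ (Fin p)) {t : ℕ} {c : ℝ} (hc : 0 ≤ c)
    (hx : ∀ s ∈ Finset.Icc 1 t, ∀ i ∈ Finset.Icc 1 (n s), ‖x s i‖ ≤ c)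
    (v : EuclideanSpace ℝ (Fin p)) :
    ‖cumCurv τ n x y path t v‖ ≤ c ^ 2 * (totalSize n t * ‖v‖) := by
  have h : ‖cumCurv τ n x y path t v‖ ≤
      ∑ s ∈ Finset.Icc 1 t, ∑ i ∈ Finset.Icc 1 (n s), c ^ 2 * ‖v‖ := by
    refine norm_sum_le_of_le _ fun s hs => norm_sum_le_of_le _ fun i hi => ?_
    have h0 := hx s hs i hi
    have h1 : |inner ℝ (x s i) v| ≤ c * ‖v‖ :=
      (abs_real_inner_le_norm _ _).trans (mul_le_mul_of_nonneg_right h0 (norm_nonneg _))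
    rw [norm_smul, Real.norm_eq_abs, abs_mul, abs_of_nonneg (weight_nonneg _ _)]
    calc weight τ _ * |inner ℝ (x s i) v| * ‖x s i‖ ≤ 1 * (c * ‖v‖) * c := by
          gcongr
          exact weight_le_one hτ _
      _ = c ^ 2 * ‖v‖ := by ring
  refine h.trans (le_of_eq ?_)
  simp only [Finset.sum_const, Nat.card_Icc, totalSize, nsmul_eq_mul, Nat.add_sub_cancel,
    ← Finset.sum_mul]
  push_cast
  ring

/-- Constants of the square root rates of the successive renewable estimators. -/
noncomputable def rateConst (c K l : ℝ) : ℕ → ℝ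
  | 0 => 0
  | t + 1 => (c ^ 2 * rateConst c K l t + K) / l

lemma rateConst_nonneg {c K l : ℝ} (hK : 0 ≤ K) (hl : 0 ≤ l) (t : ℕ) :
    0 ≤ rateConst c K l t := by
  induction t with
  | zero => exact le_rfl
  | succ t ih => rw [rateConst]; positivity

variable {τ : ℝ} {n : ℕ → ℕ} {x : ℕ → ℕ → EuclideanSpace ℝ (Fin p)} {y : ℕ → ℕ → ℝ}
  {path : ℕ → EuclideanSpace ℝ (Fin p)} {β₀ : EuclideanSpace ℝ (Fin p)} {b : ℕ} {c K l : ℝ}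

/-- Square root rate of the renewable estimators, for data with a small score at `β₀` and a
nondegenerate design. -/
lemma IsRenewable.norm_sub_mul_sqrt_le (hτ : τ ∈ Set.Ioo (0 : ℝ) 1) (hn : 0 < n 1)
    (h : IsRenewable τ n x y b path) (hc : 0 ≤ c) (hl : 0 < l)
    (hx : ∀ s ∈ Finset.Icc 1 b, ∀ i ∈ Finset.Icc 1 (n s), ‖x s i‖ ≤ c)
    (hscore : ∀ t ∈ Finset.Icc 1 b, ‖batchGrad τ (n t) (x t) (y t) β₀‖ ≤ K * √(n t))
    (hdesign : ∀ t ∈ Finset.Icc 1 b, ∀ v : EuclideanSpace ℝ (Fin p),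
      l * totalSize n t * ‖v‖ ^ 2 ≤
        ∑ s ∈ Finset.Icc 1 t, ∑ i ∈ Finset.Icc 1 (n s), (inner ℝ (x s i) v) ^ 2)
    (hK : 0 ≤ K) (t : ℕ) (ht : t ≤ b) :
    ‖path t - β₀‖ * √(totalSize n t) ≤ rateConst c K (min τ (1 - τ) * l) t := by
  induction t with
  -- N_0 = 0 annihilates the arbitrary `path 0`.
  | zero => simp [totalSize, rateConst]
  | succ t ih =>
    have ih := ih (by omega)
    have hm := min_pos_of_mem hτ
    have htb : t + 1 ∈ Finset.Icc 1 b := Finset.mem_Icc.2 ⟨by omega, ht⟩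
    have hfoc := h.cumCurv_add_batchGrad_eq_zero hτ hn (Nat.le_add_left 1 t) ht
    rw [Nat.add_sub_cancel] at hfoc
    set d := path (t + 1) - β₀ with hd
    set m := min τ (1 - τ) with hmdef
    have h1 := min_mul_sum_sq_le_inner_cumCurv hτ n x y path t d
    have h2 := min_mul_sum_sq_le_inner_batchGrad_sub hτ (n (t + 1)) (x (t + 1)) (y (t + 1))
      (path (t + 1)) β₀
    have h3 := mul_le_mul_of_nonneg_left (hdesign _ htb d) hm.le
    rw [Finset.sum_Icc_succ_top (by omega), mul_add] at h3
    -- The first-order condition recentred at β₀: the left side is strongly monotone in d, the right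
    -- side involves only the previous error and the score at β₀.
    have h4 : cumCurv τ n x y path t d + (batchGrad τ (n (t + 1)) (x (t + 1)) (y (t + 1))
        (path (t + 1)) - batchGrad τ (n (t + 1)) (x (t + 1)) (y (t + 1)) β₀) =
        -(cumCurv τ n x y path t (β₀ - path t) +
          batchGrad τ (n (t + 1)) (x (t + 1)) (y (t + 1)) β₀) := by
      have : d = (path (t + 1) - path t) - (β₀ - path t) := by rw [hd]; abel
      rw [this, cumCurv_sub]
      rw [eq_neg_of_add_eq_zero_left hfoc]
      abel
    have h5 : inner ℝ (-(cumCurv τ n x y path t (β₀ - path t) +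
        batchGrad τ (n (t + 1)) (x (t + 1)) (y (t + 1)) β₀)) d ≤
        (c ^ 2 * (totalSize n t * ‖path t - β₀‖) + K * √(n (t + 1))) * ‖d‖ := by
      refine (real_inner_le_norm _ _).trans (mul_le_mul_of_nonneg_right ?_ (norm_nonneg _))
      rw [norm_neg, norm_sub_rev (path t) β₀]
      refine norm_add_le_of_le (norm_cumCurv_le hτ y path hc (fun s hs => hx s ?_) _)
        (hscore _ htb)
      exact Finset.Icc_subset_Icc_right (by omega) hs
    rw [← h4, inner_add_left] at h5
    have h6 : m * (l * totalSize n (t + 1) * ‖d‖ ^ 2) ≤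
        (c ^ 2 * (totalSize n t * ‖path t - β₀‖) + K * √(n (t + 1))) * ‖d‖ := by linarith
    have hNpos : (0 : ℝ) < totalSize n (t + 1) := by
      exact_mod_cast hn.trans_le (le_totalSize n le_rfl (by omega))
    set q := √(totalSize n (t + 1) : ℝ) with hq
    have hqpos : 0 < q := Real.sqrt_pos.2 hNpos
    have hqq : q * q = totalSize n (t + 1) := Real.mul_self_sqrt hNpos.le
    -- N_t = √N_t √N_t: one root is absorbed by the inductive rate, the other is at most √N_{t+1}.
    have h7 : (totalSize n t : ℝ) * ‖path t - β₀‖ ≤ q * rateConst c K (m * l) t := by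
      rw [← Real.mul_self_sqrt (Nat.cast_nonneg (totalSize n t)), mul_assoc,
        mul_comm _ ‖path t - β₀‖]
      refine mul_le_mul (Real.sqrt_le_sqrt ?_) ih (by positivity) hqpos.le
      exact_mod_cast totalSize_mono n (Nat.le_succ t)
    have h8 : √(n (t + 1) : ℝ) ≤ q := by
      refine Real.sqrt_le_sqrt ?_
      exact_mod_cast le_totalSize n (by omega) le_rfl
    have h9 : c ^ 2 * (totalSize n t * ‖path t - β₀‖) + K * √(n (t + 1)) ≤
        (c ^ 2 * rateConst c K (m * l) t + K) * q := by
      have := mul_le_mul_of_nonneg_left h7 (sq_nonneg c)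
      have := mul_le_mul_of_nonneg_left h8 hK
      linarith
    rw [rateConst, le_div_iff₀ (by positivity)]
    rcases (norm_nonneg d).eq_or_lt with h0 | h0
    · have := rateConst_nonneg (c := c) (l := m * l) hK (by positivity) t
      rw [← h0]
      simp only [zero_mul]
      positivity
    · have h10 := h6.trans (mul_le_mul_of_nonneg_right h9 h0.le)
      rw [← hqq] at h10
      refine le_of_mul_le_mul_right (a := q * ‖d‖) ?_ (by positivity)
      linarith

/-- Collects the surrogate error observation by observation, in the form bounded by
`abs_score_linearization_le`; the weights stay at `path s`, not at β. -/
lemma sum_batchGrad_sub_sub_cumCurv_eq (t : ℕ) (β β' : EuclideanSpace ℝ (Fin p)) :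
    ∑ s ∈ Finset.Icc 1 t, batchGrad τ (n s) (x s) (y s) β'
      - ∑ s ∈ Finset.Icc 1 t, batchGrad τ (n s) (x s) (y s) β
      - cumCurv τ n x y path t (β' - β) =
    -∑ s ∈ Finset.Icc 1 t, ∑ i ∈ Finset.Icc 1 (n s),
      (score τ (y s i - inner ℝ (x s i) β') - score τ (y s i - inner ℝ (x s i) β) +
        weight τ (y s i - inner ℝ (x s i) (path s)) *
          (inner ℝ (x s i) β' - inner ℝ (x s i) β)) • x s i := by
  simp only [batchGrad, cumCurv, add_smul, sub_smul, Finset.sum_add_distrib,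
    Finset.sum_sub_distrib, Finset.sum_neg_distrib, inner_sub_right]
  abel

/-- The gradient of the full loss at a renewable estimate is bounded. -/
lemma IsRenewable.norm_sum_batchGrad_le (hτ : τ ∈ Set.Ioo (0 : ℝ) 1) (hn : 0 < n 1)
    (h : IsRenewable τ n x y b path) (hc : 0 ≤ c)
    (hx : ∀ s ∈ Finset.Icc 1 b, ∀ i ∈ Finset.Icc 1 (n s), ‖x s i‖ ≤ c) {R L : ℝ} (hR : 0 ≤ R)
    (hL : 0 ≤ L)
    (hrate : ∀ t ∈ Finset.Icc 1 b, ‖path t - β₀‖ * √(totalSize n t) ≤ R)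
    (hcount : ∀ s ∈ Finset.Icc 1 b, (∑ i ∈ Finset.Icc 1 (n s),
      if |y s i - inner ℝ (x s i) β₀| ≤ c * R / √(totalSize n s) then (1 : ℝ) else 0) ≤
        L * (n s / √(totalSize n s)))
    (t : ℕ) (ht : t ≤ b) :
    ‖∑ s ∈ Finset.Icc 1 t, batchGrad τ (n s) (x s) (y s) (path t)‖ ≤
      t * (b * (4 * c ^ 2 * R * L)) := by
  induction t with
  | zero => simp
  | succ t ih =>
    have ih := ih (by omega)
    have hfoc := h.cumCurv_add_batchGrad_eq_zero hτ hn (Nat.le_add_left 1 t) ht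
    rw [Nat.add_sub_cancel] at hfoc
    have hpos : ∀ s, 1 ≤ s → 0 < √(totalSize n s : ℝ) := fun s hs => Real.sqrt_pos.2 (by
      exact_mod_cast hn.trans_le (le_totalSize n le_rfl hs))
    have hdist : ∀ s, 1 ≤ s → ∀ u, s ≤ u → u ≤ b →
        ‖path u - β₀‖ ≤ R / √(totalSize n s) := by
      intro s hs u hsu hub
      refine ((le_div_iff₀ (hpos u (hs.trans hsu))).2
        (hrate u (Finset.mem_Icc.2 ⟨hs.trans hsu, hub⟩))).trans ?_
      refine div_le_div_of_nonneg_left hR (hpos s hs) (Real.sqrt_le_sqrt ?_)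
      exact_mod_cast totalSize_mono n hsu
    have key : ‖∑ s ∈ Finset.Icc 1 t, batchGrad τ (n s) (x s) (y s) (path (t + 1))
        - ∑ s ∈ Finset.Icc 1 t, batchGrad τ (n s) (x s) (y s) (path t)
        - cumCurv τ n x y path t (path (t + 1) - path t)‖ ≤ b * (4 * c ^ 2 * R * L) := by
      rw [sum_batchGrad_sub_sub_cumCurv_eq, norm_neg]
      have hterm : ∀ s ∈ Finset.Icc 1 t, ‖∑ i ∈ Finset.Icc 1 (n s),
          (score τ (y s i - inner ℝ (x s i) (path (t + 1)))
            - score τ (y s i - inner ℝ (x s i) (path t)) +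
          weight τ (y s i - inner ℝ (x s i) (path s)) *
            (inner ℝ (x s i) (path (t + 1)) - inner ℝ (x s i) (path t))) • x s i‖
          ≤ 4 * c ^ 2 * R * L := by
        intro s hs
        obtain ⟨hs1, hst⟩ := Finset.mem_Icc.1 hs
        have hsb : s ∈ Finset.Icc 1 b := Finset.mem_Icc.2 ⟨hs1, by omega⟩
        have hqs := hpos s hs1
        have hqt := hpos t (hs1.trans hst)
        have hi : ∀ i ∈ Finset.Icc 1 (n s),
            ‖(score τ (y s i - inner ℝ (x s i) (path (t + 1)))
              - score τ (y s i - inner ℝ (x s i) (path t)) +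
            weight τ (y s i - inner ℝ (x s i) (path s)) *
              (inner ℝ (x s i) (path (t + 1)) - inner ℝ (x s i) (path t))) • x s i‖
            ≤ 4 * c ^ 2 * R / √(totalSize n t) *
              (if |y s i - inner ℝ (x s i) β₀| ≤ c * R / √(totalSize n s) then 1 else 0) := by
          intro i hi
          have hxi := hx s hsb i hi
          have ha : ∀ u, s ≤ u → u ≤ b →
              |inner ℝ (x s i) (path u - β₀)| ≤ c * R / √(totalSize n s) := by
            intro u hsu hub
            rw [mul_div_assoc]
            exact (abs_real_inner_le_norm _ _).trans
              (mul_le_mul hxi (hdist s hs1 u hsu hub) (norm_nonneg _) hc)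
          have hlin := abs_score_linearization_le hτ (e := y s i - inner ℝ (x s i) β₀)
            (ha t hst (by omega)) (ha (t + 1) (by omega) ht) (ha s le_rfl (by omega))
          have he : ∀ u, y s i - inner ℝ (x s i) β₀ - inner ℝ (x s i) (path u - β₀) =
              y s i - inner ℝ (x s i) (path u) := fun u => by rw [inner_sub_right]; ring
          have he' : inner ℝ (x s i) (path (t + 1) - β₀) - inner ℝ (x s i) (path t - β₀) =
              inner ℝ (x s i) (path (t + 1)) - inner ℝ (x s i) (path t) := by
            simp only [inner_sub_right]; ring
          rw [he, he, he, he'] at hlin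
          have hdiff : |inner ℝ (x s i) (path (t + 1)) - inner ℝ (x s i) (path t)| ≤
              c * (2 * R / √(totalSize n t)) := by
            rw [← inner_sub_right]
            refine (abs_real_inner_le_norm _ _).trans (mul_le_mul hxi ?_ (norm_nonneg _) hc)
            rw [← sub_sub_sub_cancel_right _ _ β₀]
            refine (norm_sub_le _ _).trans ?_
            have h1 := hdist t (hs1.trans hst) (t + 1) (by omega) ht
            have h2 := hdist t (hs1.trans hst) t le_rfl (by omega)
            rw [mul_div_assoc]
            linarith
          rw [norm_smul, Real.norm_eq_abs]
          refine (mul_le_mul hlin hxi (norm_nonneg _) (by positivity)).trans ?_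
          split_ifs
          · rw [mul_one, mul_one]
            calc _ ≤ 2 * (c * (2 * R / √(totalSize n t))) * c := by gcongr
              _ = _ := by ring
          · simp
        refine (norm_sum_le_of_le _ hi).trans ?_
        rw [← Finset.mul_sum]
        refine (mul_le_mul_of_nonneg_left (hcount s hsb) (by positivity)).trans ?_
        -- The count is at most of order √N_t, which cancels the 1/√N_t of the step length.
        have hle : (n s : ℝ) / √(totalSize n s) ≤ √(totalSize n t) := by
          rw [div_le_iff₀ hqs]
          calc (n s : ℝ) ≤ totalSize n s := by exact_mod_cast le_totalSize n hs1 le_rfl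
            _ = √(totalSize n s) * √(totalSize n s) :=
              (Real.mul_self_sqrt (Nat.cast_nonneg _)).symm
            _ ≤ √(totalSize n t) * √(totalSize n s) := by
              gcongr
              exact totalSize_mono n hst
        calc 4 * c ^ 2 * R / √(totalSize n t) * (L * (n s / √(totalSize n s)))
            ≤ 4 * c ^ 2 * R / √(totalSize n t) * (L * √(totalSize n t)) := by gcongr
          _ = 4 * c ^ 2 * R * L := by field_simp
      refine (norm_sum_le_of_le _ hterm).trans ?_
      rw [Finset.sum_const, Nat.card_Icc, nsmul_eq_mul, Nat.add_sub_cancel]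
      refine mul_le_mul_of_nonneg_right ?_ (by positivity)
      exact_mod_cast (by omega : t ≤ b)
    -- The first-order condition replaces the gradient of the new batch by minus the curvature term,
    -- so the full gradient changes by the linearization error alone.
    have hsplit : ∑ s ∈ Finset.Icc 1 (t + 1), batchGrad τ (n s) (x s) (y s) (path (t + 1)) =
        ∑ s ∈ Finset.Icc 1 t, batchGrad τ (n s) (x s) (y s) (path t) +
        (∑ s ∈ Finset.Icc 1 t, batchGrad τ (n s) (x s) (y s) (path (t + 1))
        - ∑ s ∈ Finset.Icc 1 t, batchGrad τ (n s) (x s) (y s) (path t)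
        - cumCurv τ n x y path t (path (t + 1) - path t)) := by
      rw [Finset.sum_Icc_succ_top (by omega)]
      rw [eq_neg_of_add_eq_zero_left hfoc]
      abel
    rw [hsplit]
    refine (norm_add_le_of_le ih key).trans (le_of_eq ?_)
    push_cast
    ring

/-- The distance of the renewable to the oracle estimate, for data with a small score at `β₀`,
a nondegenerate design and few small errors. -/
lemma IsRenewable.norm_sub_oracle_le (hτ : τ ∈ Set.Ioo (0 : ℝ) 1) (hb : 1 ≤ b) (hn : 0 < n 1)
    (h : IsRenewable τ n x y b path) {β' : EuclideanSpace ℝ (Fin p)}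
    (h' : IsOracle τ n x y b β') (hc : 0 ≤ c) (hl : 0 < l) (hK : 0 ≤ K)
    (hx : ∀ s ∈ Finset.Icc 1 b, ∀ i ∈ Finset.Icc 1 (n s), ‖x s i‖ ≤ c)
    (hscore : ∀ t ∈ Finset.Icc 1 b, ‖batchGrad τ (n t) (x t) (y t) β₀‖ ≤ K * √(n t))
    (hdesign : ∀ t ∈ Finset.Icc 1 b, ∀ v : EuclideanSpace ℝ (Fin p),
      l * totalSize n t * ‖v‖ ^ 2 ≤
        ∑ s ∈ Finset.Icc 1 t, ∑ i ∈ Finset.Icc 1 (n s), (inner ℝ (x s i) v) ^ 2)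
    {R L : ℝ} (hL : 0 ≤ L)
    (hR : ∀ t ∈ Finset.Icc 1 b, rateConst c K (min τ (1 - τ) * l) t ≤ R)
    (hcount : ∀ s ∈ Finset.Icc 1 b, (∑ i ∈ Finset.Icc 1 (n s),
      if |y s i - inner ℝ (x s i) β₀| ≤ c * R / √(totalSize n s) then (1 : ℝ) else 0) ≤
        L * (n s / √(totalSize n s))) :
    ‖path b - β'‖ ≤
      b * (b * (4 * c ^ 2 * R * L)) / (min τ (1 - τ) * l) * (1 / totalSize n b) := by
  have hm := min_pos_of_mem hτ
  have hbb : b ∈ Finset.Icc 1 b := Finset.mem_Icc.2 ⟨hb, le_rfl⟩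
  have hR0 : 0 ≤ R := (rateConst_nonneg hK (by positivity) b).trans (hR b hbb)
  have hN : 0 < totalSize n b := hn.trans_le (le_totalSize n le_rfl hb)
  have hgrad := h.norm_sum_batchGrad_le hτ hn hc hx hR0 hL
    (fun t ht => (h.norm_sub_mul_sqrt_le hτ hn hc hl hx hscore hdesign hK t
      (Finset.mem_Icc.1 ht).2).trans (hR t ht)) hcount b le_rfl
  have hfoc := h'.sum_batchGrad_eq_zero hτ hN
  have h1 : min τ (1 - τ) * (l * totalSize n b * ‖path b - β'‖ ^ 2) ≤
      inner ℝ (∑ s ∈ Finset.Icc 1 b, batchGrad τ (n s) (x s) (y s) (path b)) (path b - β') := by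
    refine (mul_le_mul_of_nonneg_left (hdesign b hbb _) hm.le).trans ?_
    -- The zero is the full gradient at the oracle estimate.
    rw [← sub_zero (∑ s ∈ Finset.Icc 1 b, batchGrad τ (n s) (x s) (y s) (path b)), ← hfoc,
      ← Finset.sum_sub_distrib, sum_inner, Finset.mul_sum]
    exact Finset.sum_le_sum fun s _ => min_mul_sum_sq_le_inner_batchGrad_sub hτ _ _ _ _ _
  have h2 := h1.trans ((real_inner_le_norm _ _).trans
    (mul_le_mul_of_nonneg_right hgrad (norm_nonneg _)))
  have hN' : (0 : ℝ) < totalSize n b := by exact_mod_cast hN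
  rw [div_mul_div_comm, mul_one, le_div_iff₀ (by positivity)]
  rcases (norm_nonneg (path b - β')).eq_or_lt with h0 | h0
  · rw [← h0, zero_mul]; positivity
  · refine le_of_mul_le_mul_right (a := ‖path b - β'‖) ?_ h0
    linarith

end deterministic

/-! ### Chebyshev and Markov bounds for sums -/

section tail

variable {Ω S ι : Type*} [MeasurableSpace Ω] [MeasurableSpace S] {P : Measure Ω}
  [IsProbabilityMeasure P] {μ : Measure S} {U : Finset ι} {W : ι → Ω → S}

/-- Chebyshev's inequality for a sum of pairwise independent centered variables of common law. -/
lemma measure_lt_abs_sum_le (hW : ∀ i ∈ U, Measurable (W i)) (hlaw : ∀ i ∈ U, P.map (W i) = μ)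
    (hind : (U : Set ι).Pairwise fun i j => IndepFun (W i) (W j) P) {f : S → ℝ}
    (hf : Measurable f) (hL2 : MemLp f 2 μ) (h0 : ∫ z, f z ∂μ = 0) {C : ℝ}
    (hC : ∫ z, f z ^ 2 ∂μ ≤ C) {a : ℝ} (ha : 0 < a) :
    P {ω | a < |∑ i ∈ U, f (W i ω)|} ≤ ENNReal.ofReal (U.card * C / a ^ 2) := by
  have hmem : ∀ i ∈ U, MemLp (f ∘ W i) 2 P := fun i hi => by
    rw [← hlaw i hi] at hL2
    exact hL2.comp_of_map (hW i hi).aemeasurable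
  have hint : ∀ i ∈ U, ∫ ω, (f ∘ W i) ω ∂P = 0 := fun i hi => by
    rw [← hlaw i hi, integral_map (hW i hi).aemeasurable hf.aestronglyMeasurable] at h0
    exact h0
  have hvar : ∀ i ∈ U, variance (f ∘ W i) P ≤ C := fun i hi => by
    rw [variance_of_integral_eq_zero (hf.comp (hW i hi)).aemeasurable (hint i hi)]
    rw [← hlaw i hi, integral_map (hW i hi).aemeasurable
      (hf.pow_const 2).aestronglyMeasurable] at hC
    exact hC
  have hsum : ∫ ω, (∑ i ∈ U, f ∘ W i) ω ∂P = 0 := by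
    simp only [Finset.sum_apply]
    rw [integral_finsetSum _ fun i hi => (hmem i hi).integrable one_le_two]
    exact Finset.sum_eq_zero hint
  have key := meas_ge_le_variance_div_sq (memLp_finsetSum' U hmem) ha
  rw [hsum] at key
  refine (measure_mono fun ω hω => ?_).trans (key.trans (ENNReal.ofReal_le_ofReal ?_))
  · simpa using le_of_lt hω
  · refine div_le_div_of_nonneg_right ?_ (sq_nonneg a)
    rw [IndepFun.variance_sum hmem fun i hi j hj hij => (hind hi hj hij).comp hf hf]
    refine (Finset.sum_le_sum hvar).trans (le_of_eq ?_)
    rw [Finset.sum_const, nsmul_eq_mul]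

/-- Markov's inequality for the number of variables with values in a given set. -/
lemma measure_lt_sum_ite_le (hW : ∀ i ∈ U, Measurable (W i)) (hlaw : ∀ i ∈ U, P.map (W i) = μ)
    {A : S → Prop} [DecidablePred A] (hA : MeasurableSet {z | A z}) {q : ℝ}
    (hq : μ.real {z | A z} ≤ q) {a : ℝ} (ha : 0 < a) :
    P {ω | a < ∑ i ∈ U, if A (W i ω) then (1 : ℝ) else 0} ≤
      ENNReal.ofReal (U.card * q / a) := by
  have hterm : ∀ i ∈ U, Integrable (fun ω => if A (W i ω) then (1 : ℝ) else 0) P ∧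
      ∫ ω, (if A (W i ω) then (1 : ℝ) else 0) ∂P ≤ q := fun i hi => by
    have hm : MeasurableSet {ω | A (W i ω)} := hW i hi hA
    have he : (fun ω => if A (W i ω) then (1 : ℝ) else 0) =
        {ω | A (W i ω)}.indicator 1 := by
      ext ω; simp [Set.indicator_apply]
    rw [he]
    refine ⟨(integrable_const 1).indicator hm, ?_⟩
    rw [integral_indicator_one hm]
    rw [← hlaw i hi, map_measureReal_apply (hW i hi) hA] at hq
    exact hq
  have hint : ∫ ω, (∑ i ∈ U, if A (W i ω) then (1 : ℝ) else 0) ∂P ≤ U.card * q := by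
    rw [integral_finsetSum _ fun i hi => (hterm i hi).1]
    refine (Finset.sum_le_sum fun i hi => (hterm i hi).2).trans (le_of_eq ?_)
    rw [Finset.sum_const, nsmul_eq_mul]
  have key := mul_meas_ge_le_integral_of_nonneg (μ := P)
    (f := fun ω => ∑ i ∈ U, if A (W i ω) then (1 : ℝ) else 0)
    (Eventually.of_forall fun ω => Finset.sum_nonneg fun i _ => by split_ifs <;> norm_num)
    (integrable_finsetSum _ fun i hi => (hterm i hi).1) a
  have hsub : {ω | a < ∑ i ∈ U, if A (W i ω) then (1 : ℝ) else 0} ⊆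
      {ω | a ≤ ∑ i ∈ U, if A (W i ω) then (1 : ℝ) else 0} := Set.ofPred_subset_ofPred.2
    fun ω hω => le_of_lt hω
  refine (measure_mono hsub).trans ?_
  rw [← ofReal_measureReal]
  refine ENNReal.ofReal_le_ofReal ?_
  rw [le_div_iff₀ ha, mul_comm]
  exact key.trans hint

end tail

/-- The first-order condition of the expectile of a law with a finite second moment. -/
lemma IsExpectile.integral_score_eq_zero {τ : ℝ} (hτ : τ ∈ Set.Ioo (0 : ℝ) 1) {m : Measure ℝ}
    [IsProbabilityMeasure m] (hm : MemLp id 2 m) (h : IsExpectile τ m 0) :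
    ∫ u, score τ u ∂m = 0 := by
  have hscore : Integrable (score τ) m :=
    (hm.integrable one_le_two).mono (measurable_score τ).aestronglyMeasurable
      (Eventually.of_forall fun u => abs_score_le hτ u)
  have hrho : ∀ s : ℝ, Integrable (fun u => rho τ (u - s)) m := fun s => by
    have h1 : MemLp (fun u : ℝ => u - s) 2 m := hm.sub (memLp_const s)
    refine h1.integrable_sq.mono
      ((measurable_rho τ).comp (measurable_id.sub_const s)).aestronglyMeasurable
      (Eventually.of_forall fun u => ?_)
    rw [rho_eq, Real.norm_eq_abs, Real.norm_eq_abs, abs_mul, abs_of_nonneg (by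
      have := weight_nonneg τ (u - s); positivity)]
    nlinarith [weight_le_one hτ (u - s), abs_nonneg ((u - s) ^ 2)]
  refine neg_eq_zero.1 (eq_zero_of_isMinOn_of_le_quadratic (C := 1 / 2) h fun s => ?_)
  have hle : ∫ u, rho τ (u - (0 + s)) ∂m ≤
      ∫ u, (rho τ (u - 0) + score τ u * -s + 1 / 2 * s ^ 2) ∂m := by
    refine integral_mono (hrho _)
      (((hrho 0).add (hscore.mul_const _)).add (integrable_const _)) fun u => ?_
    have h1 := rho_add_le hτ u (-s)
    simp only [zero_add, sub_zero]
    rw [neg_sq, ← sub_eq_add_neg] at h1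
    exact h1
  refine hle.trans (le_of_eq ?_)
  have hadd : Integrable (fun u => rho τ (u - 0) + score τ u * -s) m :=
    (hrho 0).add (hscore.mul_const _)
  rw [integral_add hadd (integrable_const _),
    integral_add (hrho 0) (hscore.mul_const _), integral_mul_const]
  simp [mul_comm]

/-- A bound on the lower Lebesgue integral includes finiteness; a Bochner integral would default to
0 for a heavy tail. -/
lemma memLp_id_of_lintegral_sq_le {m : Measure ℝ} {c : ℝ}
    (h : ∫⁻ u, ENNReal.ofReal (u ^ 2) ∂m ≤ ENNReal.ofReal c) : MemLp id 2 m := by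
  rw [memLp_two_iff_integrable_sq measurable_id.aestronglyMeasurable]
  refine ⟨(measurable_id.pow_const 2).aestronglyMeasurable, ?_⟩
  rw [hasFiniteIntegral_iff_ofReal (Eventually.of_forall fun u => sq_nonneg _)]
  exact h.trans_lt ENNReal.ofReal_lt_top

/-! ### Moments and small-ball bounds under the model law -/

section model

variable {p : ℕ} {τ : ℝ} {c₁ c₃ c₄ : ℝ}
  {π : Measure (EuclideanSpace ℝ (Fin p))} [IsProbabilityMeasure π]
  {κ : Kernel (EuclideanSpace ℝ (Fin p)) ℝ} [IsMarkovKernel κ]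

lemma abs_apply_le_norm (v : EuclideanSpace ℝ (Fin p)) (j : Fin p) : |v j| ≤ ‖v‖ :=
  PiLp.norm_apply_le v j

lemma measurable_apply_fst (j : Fin p) :
    Measurable fun z : EuclideanSpace ℝ (Fin p) × ℝ => z.1 j := by
  fun_prop

lemma ae_compProd_norm_fst_lt (h_bdd : ∀ᵐ v ∂π, ‖v‖ < c₄) :
    ∀ᵐ z ∂(π ⊗ₘ κ), ‖z.1‖ < c₄ := by
  rw [← Measure.fst_compProd π κ, Measure.fst] at h_bdd
  exact ae_of_ae_map measurable_fst.aemeasurable h_bdd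

lemma integrable_sq_snd_compProd (hc₁ : 0 ≤ c₁)
    (h_moment : ∀ᵐ v ∂π, ∫⁻ u, ENNReal.ofReal (u ^ 2) ∂(κ v) ≤ ENNReal.ofReal c₁) :
    Integrable (fun z : EuclideanSpace ℝ (Fin p) × ℝ => z.2 ^ 2) (π ⊗ₘ κ) ∧
      ∫ z, z.2 ^ 2 ∂(π ⊗ₘ κ) ≤ c₁ := by
  have hm : Measurable fun z : EuclideanSpace ℝ (Fin p) × ℝ => z.2 ^ 2 :=
    measurable_snd.pow_const 2
  have h1 : ∫⁻ z, ENNReal.ofReal (z.2 ^ 2) ∂(π ⊗ₘ κ) ≤ ENNReal.ofReal c₁ := by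
    rw [Measure.lintegral_compProd hm.ennreal_ofReal]
    refine (lintegral_mono_ae h_moment).trans (le_of_eq ?_)
    simp
  have h0 : 0 ≤ᵐ[π ⊗ₘ κ] fun z : EuclideanSpace ℝ (Fin p) × ℝ => z.2 ^ 2 :=
    Eventually.of_forall fun z => sq_nonneg _
  have hi : Integrable (fun z : EuclideanSpace ℝ (Fin p) × ℝ => z.2 ^ 2) (π ⊗ₘ κ) := by
    refine ⟨hm.aestronglyMeasurable, ?_⟩
    rw [hasFiniteIntegral_iff_ofReal h0]
    exact h1.trans_lt ENNReal.ofReal_lt_top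
  refine ⟨hi, ?_⟩
  rw [← ofReal_integral_eq_lintegral_ofReal hi h0, ENNReal.ofReal_le_ofReal_iff hc₁] at h1
  exact h1

/-- The coordinates of the score at the true parameter are centered and square integrable. -/
lemma memLp_score_mul (hτ : τ ∈ Set.Ioo (0 : ℝ) 1) (hc₁ : 0 ≤ c₁) (hc₄ : 0 ≤ c₄)
    (h_expectile : ∀ᵐ v ∂π, IsExpectile τ (κ v) 0)
    (h_moment : ∀ᵐ v ∂π, ∫⁻ u, ENNReal.ofReal (u ^ 2) ∂(κ v) ≤ ENNReal.ofReal c₁)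
    (h_bdd : ∀ᵐ v ∂π, ‖v‖ < c₄) (j : Fin p) :
    Measurable (fun z : EuclideanSpace ℝ (Fin p) × ℝ => score τ z.2 * z.1 j) ∧
    MemLp (fun z : EuclideanSpace ℝ (Fin p) × ℝ => score τ z.2 * z.1 j) 2 (π ⊗ₘ κ) ∧
    ∫ z, score τ z.2 * z.1 j ∂(π ⊗ₘ κ) = 0 ∧
    ∫ z, (score τ z.2 * z.1 j) ^ 2 ∂(π ⊗ₘ κ) ≤ c₄ ^ 2 * c₁ := by
  have hm : Measurable (fun z : EuclideanSpace ℝ (Fin p) × ℝ => score τ z.2 * z.1 j) :=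
    ((measurable_score τ).comp measurable_snd).mul (measurable_apply_fst j)
  obtain ⟨hi, hi1⟩ := integrable_sq_snd_compProd (p := p) hc₁ h_moment
  have hle : ∀ᵐ z ∂(π ⊗ₘ κ), (score τ z.2 * z.1 j) ^ 2 ≤ c₄ ^ 2 * z.2 ^ 2 := by
    filter_upwards [ae_compProd_norm_fst_lt (κ := κ) h_bdd] with z hz
    rw [← mul_pow, sq_le_sq, abs_mul, abs_mul, abs_of_nonneg hc₄, mul_comm]
    exact mul_le_mul ((abs_apply_le_norm _ _).trans hz.le) (abs_score_le hτ _) (abs_nonneg _) hc₄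
  have hsq : Integrable (fun z : EuclideanSpace ℝ (Fin p) × ℝ => (score τ z.2 * z.1 j) ^ 2)
      (π ⊗ₘ κ) := by
    refine (hi.const_mul (c₄ ^ 2)).mono (hm.pow_const 2).aestronglyMeasurable ?_
    filter_upwards [hle] with z hz
    rw [Real.norm_of_nonneg (sq_nonneg _), Real.norm_of_nonneg (by positivity)]
    exact hz
  have hL2 := (memLp_two_iff_integrable_sq hm.aestronglyMeasurable).2 hsq
  refine ⟨hm, hL2, ?_, ?_⟩
  -- Given the covariate, its coordinate factors out and the conditional mean of the score is 0 by
  -- the expectile condition.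
  · rw [Measure.integral_compProd (hL2.integrable one_le_two)]
    refine integral_eq_zero_of_ae ?_
    filter_upwards [h_expectile, h_moment] with v hv hv'
    simp only [Pi.zero_apply]
    rw [integral_mul_const, hv.integral_score_eq_zero hτ (memLp_id_of_lintegral_sq_le hv'),
      zero_mul]
  · refine (integral_mono_ae hsq (hi.const_mul _) hle).trans ?_
    rw [integral_const_mul]
    gcongr

/-- The centered products of the coordinates of the covariate are bounded. -/
lemma memLp_mul_sub_secondMoment (h_bdd : ∀ᵐ v ∂π, ‖v‖ < c₄) (j k : Fin p) :
    Measurable (fun z : EuclideanSpace ℝ (Fin p) × ℝ => z.1 j * z.1 k - secondMoment π j k) ∧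
    MemLp (fun z : EuclideanSpace ℝ (Fin p) × ℝ => z.1 j * z.1 k - secondMoment π j k) 2
      (π ⊗ₘ κ) ∧
    ∫ z, (z.1 j * z.1 k - secondMoment π j k) ∂(π ⊗ₘ κ) = 0 ∧
    ∫ z, (z.1 j * z.1 k - secondMoment π j k) ^ 2 ∂(π ⊗ₘ κ) ≤ (2 * c₄ ^ 2) ^ 2 := by
  have hmul : ∀ v : EuclideanSpace ℝ (Fin p), ‖v‖ < c₄ → |v j * v k| ≤ c₄ ^ 2 := fun v hv => by
    rw [abs_mul, pow_two]
    exact mul_le_mul ((abs_apply_le_norm _ _).trans hv.le) ((abs_apply_le_norm _ _).trans hv.le)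
      (abs_nonneg _) ((norm_nonneg _).trans hv.le)
  have hS : |secondMoment π j k| ≤ c₄ ^ 2 := by
    have := norm_integral_le_of_norm_le_const (μ := π) (f := fun v => v j * v k) (C := c₄ ^ 2)
      (h_bdd.mono fun v hv => hmul v hv)
    simpa [secondMoment] using this
  have hm : Measurable fun z : EuclideanSpace ℝ (Fin p) × ℝ => z.1 j * z.1 k :=
    (measurable_apply_fst j).mul (measurable_apply_fst k)
  have hm' := hm.sub_const (secondMoment π j k)
  have hbd := ae_compProd_norm_fst_lt (κ := κ) h_bdd
  have hbound : ∀ᵐ z ∂(π ⊗ₘ κ), |z.1 j * z.1 k - secondMoment π j k| ≤ 2 * c₄ ^ 2 := by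
    filter_upwards [hbd] with z hz
    linarith [abs_sub (z.1 j * z.1 k) (secondMoment π j k), hmul _ hz]
  have hL2 : MemLp (fun z : EuclideanSpace ℝ (Fin p) × ℝ => z.1 j * z.1 k - secondMoment π j k) 2
      (π ⊗ₘ κ) := MemLp.of_bound hm'.aestronglyMeasurable _ hbound
  have hi : Integrable (fun z : EuclideanSpace ℝ (Fin p) × ℝ => z.1 j * z.1 k) (π ⊗ₘ κ) :=
    Integrable.of_bound hm.aestronglyMeasurable (c₄ ^ 2) (hbd.mono fun z hz => hmul _ hz)
  refine ⟨hm', hL2, ?_, ?_⟩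
  · rw [integral_sub hi (integrable_const _), Measure.integral_compProd hi]
    simp [secondMoment]
  · have := integral_mono_ae hL2.integrable_sq (integrable_const ((2 * c₄ ^ 2) ^ 2))
      (hbound.mono fun z hz => sq_le_sq' (abs_le.1 hz).1 (abs_le.1 hz).2)
    simpa using this

/-- Given the covariate, the event is an interval of length 2r, of mass at most c₃ times that
length. -/
lemma measureReal_abs_snd_le (hc₃ : 0 ≤ c₃)
    (h_density : ∀ᵐ v ∂π, ∃ f : ℝ → ℝ, Measurable f ∧ (∀ u, 0 < f u ∧ f u ≤ c₃) ∧
      κ v = (volume : Measure ℝ).withDensity (fun u => ENNReal.ofReal (f u)))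
    {r : ℝ} (hr : 0 ≤ r) :
    MeasurableSet {z : EuclideanSpace ℝ (Fin p) × ℝ | |z.2| ≤ r} ∧
    (π ⊗ₘ κ).real {z | |z.2| ≤ r} ≤ c₃ * (2 * r) := by
  have hm : MeasurableSet {z : EuclideanSpace ℝ (Fin p) × ℝ | |z.2| ≤ r} :=
    measurableSet_le measurable_snd.abs measurable_const
  refine ⟨hm, ENNReal.toReal_le_of_le_ofReal (by positivity) ?_⟩
  rw [Measure.compProd_apply hm]
  have hle : ∀ᵐ v ∂π, κ v (Prod.mk v ⁻¹' {z | |z.2| ≤ r}) ≤ ENNReal.ofReal (c₃ * (2 * r)) := by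
    filter_upwards [h_density] with v hv
    obtain ⟨f, hf, hfc, hκ⟩ := hv
    have hset : Prod.mk v ⁻¹' {z : EuclideanSpace ℝ (Fin p) × ℝ | |z.2| ≤ r} = Set.Icc (-r) r := by
      ext u; simp [abs_le]
    rw [hset, hκ, withDensity_apply _ measurableSet_Icc]
    refine (lintegral_mono fun u => ENNReal.ofReal_le_ofReal (hfc u).2).trans (le_of_eq ?_)
    rw [setLIntegral_const, Real.volume_Icc, ← ENNReal.ofReal_mul hc₃]
    congr 2
    ring
  refine (lintegral_mono_ae hle).trans (le_of_eq ?_)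
  simp

omit [IsProbabilityMeasure π] in
/-- The smallest eigenvalue of the second moment matrix, as a lower bound of its quadratic form. -/
lemma exists_mul_norm_sq_le_secondMoment
    (h_eig : ∀ μ ∈ spectrum ℝ (secondMoment π), 0 < μ) :
    ∃ l > 0, ∀ v : EuclideanSpace ℝ (Fin p),
      l * ‖v‖ ^ 2 ≤ v.ofLp ⬝ᵥ (secondMoment π *ᵥ v.ofLp) := by
  have hH : (secondMoment π).IsHermitian := by
    ext j k
    simp [secondMoment, mul_comm]
  have hpos : (secondMoment π).PosDef :=
    hH.posDef_iff_eigenvalues_pos.2 fun i => h_eig _ (hH.eigenvalues_mem_spectrum_real i)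
  have hcont : Continuous fun v : EuclideanSpace ℝ (Fin p) =>
      v.ofLp ⬝ᵥ (secondMoment π *ᵥ v.ofLp) := by
    simp only [dotProduct, Matrix.mulVec]
    fun_prop
  -- The unit sphere is empty in dimension 0; otherwise l is the minimum of the form on this compact
  -- set.
  rcases (Metric.sphere (0 : EuclideanSpace ℝ (Fin p)) 1).eq_empty_or_nonempty with hS | hS
  · refine ⟨1, one_pos, fun v => ?_⟩
    have hv : v = 0 := by
      by_contra hv
      have : ‖v‖⁻¹ • v ∈ Metric.sphere (0 : EuclideanSpace ℝ (Fin p)) 1 := by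
        simp [norm_smul, hv]
      rw [hS] at this
      exact this
    simp [hv]
  · obtain ⟨w, hw, hmin⟩ := (isCompact_sphere _ _).exists_isMinOn hS hcont.continuousOn
    refine ⟨w.ofLp ⬝ᵥ (secondMoment π *ᵥ w.ofLp), ?_, fun v => ?_⟩
    · have hw0 : w.ofLp ≠ 0 := by
        intro h
        have : w = 0 := by ext i; simp [h]
        simp [this] at hw
      simpa using hpos.dotProduct_mulVec_pos hw0
    · by_cases hv : v = 0
      · simp [hv]
      · have h1 : ‖v‖⁻¹ • v ∈ Metric.sphere (0 : EuclideanSpace ℝ (Fin p)) 1 := by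
          simp [norm_smul, hv]
        have h2 := hmin h1
        have hv' : 0 < ‖v‖ := norm_pos_iff.2 hv
        simp only [Set.mem_ofPred_eq, WithLp.ofLp_smul, Matrix.mulVec_smul, smul_dotProduct,
          dotProduct_smul, smul_eq_mul] at h2
        calc _ ≤ ‖v‖⁻¹ * (‖v‖⁻¹ * (v.ofLp ⬝ᵥ (secondMoment π *ᵥ v.ofLp))) * ‖v‖ ^ 2 := by gcongr
          _ = _ := by field_simp

/-- Lower bound of the quadratic form of a sample whose second moments are near those of `π`. -/
lemma half_mul_norm_sq_le_sum_inner_sq {ι : Type*} {U : Finset ι}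
    {x : ι → EuclideanSpace ℝ (Fin p)} {S : Matrix (Fin p) (Fin p) ℝ} {l δ : ℝ} {N : ℕ}
    (hl : ∀ v : EuclideanSpace ℝ (Fin p), l * ‖v‖ ^ 2 ≤ v.ofLp ⬝ᵥ (S *ᵥ v.ofLp))
    (hδ : (p : ℝ) ^ 2 * δ ≤ l / 2) (hN : U.card = N)
    (h : ∀ j k, |∑ i ∈ U, (x i j * x i k - S j k)| ≤ δ * N) (v : EuclideanSpace ℝ (Fin p)) :
    l / 2 * N * ‖v‖ ^ 2 ≤ ∑ i ∈ U, (inner ℝ (x i) v) ^ 2 := by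
  have hS : v.ofLp ⬝ᵥ (S *ᵥ v.ofLp) = ∑ j, ∑ k, S j k * (v j * v k) := by
    simp only [dotProduct, Matrix.mulVec, Finset.mul_sum]
    exact Finset.sum_congr rfl fun j _ => Finset.sum_congr rfl fun k _ => by ring
  have hx : ∀ i, (inner ℝ (x i) v) ^ 2 = ∑ j, ∑ k, x i j * x i k * (v j * v k) := fun i => by
    rw [PiLp.inner_apply, pow_two, Finset.sum_mul_sum]
    refine Finset.sum_congr rfl fun j _ => Finset.sum_congr rfl fun k _ => ?_
    simp only [RCLike.inner_apply, conj_trivial]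
    ring
  have hsum : ∑ i ∈ U, (inner ℝ (x i) v) ^ 2 = N * (v.ofLp ⬝ᵥ (S *ᵥ v.ofLp)) +
      ∑ j, ∑ k, (∑ i ∈ U, (x i j * x i k - S j k)) * (v j * v k) := by
    have hswap : ∑ i ∈ U, (inner ℝ (x i) v) ^ 2 =
        ∑ j, ∑ k, (∑ i ∈ U, x i j * x i k) * (v j * v k) := by
      simp only [hx]
      rw [Finset.sum_comm]
      refine Finset.sum_congr rfl fun j _ => ?_
      rw [Finset.sum_comm]
      exact Finset.sum_congr rfl fun k _ => (Finset.sum_mul _ _ _).symm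
    rw [hswap, hS, Finset.mul_sum, ← Finset.sum_add_distrib]
    refine Finset.sum_congr rfl fun j _ => ?_
    rw [Finset.mul_sum, ← Finset.sum_add_distrib]
    refine Finset.sum_congr rfl fun k _ => ?_
    rw [Finset.sum_sub_distrib, Finset.sum_const, hN, nsmul_eq_mul]
    ring
  have herr : |∑ j, ∑ k, (∑ i ∈ U, (x i j * x i k - S j k)) * (v j * v k)| ≤
      (p : ℝ) ^ 2 * δ * N * ‖v‖ ^ 2 := by
    have h1 : ∀ j k, |(∑ i ∈ U, (x i j * x i k - S j k)) * (v j * v k)| ≤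
        δ * N * (‖v‖ * ‖v‖) := fun j k => by
      rw [abs_mul, abs_mul]
      exact mul_le_mul (h j k) (mul_le_mul (abs_apply_le_norm _ _) (abs_apply_le_norm _ _)
        (abs_nonneg _) (norm_nonneg _)) (by positivity) ((abs_nonneg _).trans (h j k))
    refine (Finset.abs_sum_le_sum_abs _ _).trans ((Finset.sum_le_sum fun j _ =>
      (Finset.abs_sum_le_sum_abs _ _).trans (Finset.sum_le_sum fun k _ => h1 j k)).trans
        (le_of_eq ?_))
    simp
    ring
  have h1 := mul_le_mul_of_nonneg_left (hl v) (Nat.cast_nonneg (α := ℝ) N)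
  have h2 := mul_le_mul_of_nonneg_right hδ
    (by positivity : (0 : ℝ) ≤ N * ‖v‖ ^ 2)
  rw [hsum]
  linarith [neg_abs_le (∑ j, ∑ k, (∑ i ∈ U, (x i j * x i k - S j k)) * (v j * v k))]

/-- The crude factor p in place of √p suffices and is valid at p = 0 too. -/
lemma norm_le_of_abs_apply_le {v : EuclideanSpace ℝ (Fin p)} {a : ℝ} (ha : 0 ≤ a)
    (h : ∀ j, |v j| ≤ a) : ‖v‖ ≤ p * a := by
  have h1 : ‖v‖ ^ 2 ≤ p * a ^ 2 := by
    rw [EuclideanSpace.norm_sq_eq]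
    refine (Finset.sum_le_sum fun j _ => pow_le_pow_left₀ (norm_nonneg _) (h j) 2).trans ?_
    simp
  have h2 : (p : ℝ) ≤ p ^ 2 := by exact_mod_cast Nat.le_self_pow two_ne_zero p
  refine abs_le_of_sq_le_sq' ?_ (by positivity) |>.2
  nlinarith [mul_le_mul_of_nonneg_right h2 (sq_nonneg a)]

end model

/-! ### Probabilities of the exceptional events -/

section sample

variable {p : ℕ} {τ : ℝ} {c₁ c₃ c₄ : ℝ}
  {π : Measure (EuclideanSpace ℝ (Fin p))} [IsProbabilityMeasure π]
  {κ : Kernel (EuclideanSpace ℝ (Fin p)) ℝ} [IsMarkovKernel κ]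
  {Ω ι : Type*} [MeasurableSpace Ω] {P : Measure Ω} [IsProbabilityMeasure P]
  {U : Finset ι} {W : ι → Ω → EuclideanSpace ℝ (Fin p) × ℝ}

omit [IsProbabilityMeasure P] in
lemma measure_iUnion_le_card_mul {α : Type*} [Fintype α] {A : α → Set Ω} {η : ℝ}
    (h : ∀ a, P (A a) ≤ ENNReal.ofReal η) :
    P (⋃ a, A a) ≤ ENNReal.ofReal (Fintype.card α * η) := by
  refine (measure_iUnion_fintype_le P A).trans ((Finset.sum_le_sum fun a _ => h a).trans ?_)
  rw [Finset.sum_const, nsmul_eq_mul, ENNReal.ofReal_mul (Nat.cast_nonneg _),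
    ENNReal.ofReal_natCast, Finset.card_univ]

/-- The score at the true parameter is of the order of the square root of the sample size. -/
lemma measure_lt_norm_sum_score_le (hτ : τ ∈ Set.Ioo (0 : ℝ) 1) (hc₁ : 0 ≤ c₁) (hc₄ : 0 ≤ c₄)
    (h_expectile : ∀ᵐ v ∂π, IsExpectile τ (κ v) 0)
    (h_moment : ∀ᵐ v ∂π, ∫⁻ u, ENNReal.ofReal (u ^ 2) ∂(κ v) ≤ ENNReal.ofReal c₁)
    (h_bdd : ∀ᵐ v ∂π, ‖v‖ < c₄)
    (hW : ∀ i ∈ U, Measurable (W i)) (hlaw : ∀ i ∈ U, P.map (W i) = π ⊗ₘ κ)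
    (hind : (U : Set ι).Pairwise fun i j => IndepFun (W i) (W j) P)
    {K η : ℝ} (hK : 0 < K) (hη : c₄ ^ 2 * c₁ / K ^ 2 ≤ η) :
    P {ω | p * K * √U.card < ‖∑ i ∈ U, score τ (W i ω).2 • (W i ω).1‖} ≤
      ENNReal.ofReal (p * η) := by
  -- For an empty batch the event reads 0 < 0; otherwise the batch size cancels, so no batch has to
  -- be large.
  rcases U.eq_empty_or_nonempty with rfl | hU
  · simp
  have hcard : (0 : ℝ) < U.card := by exact_mod_cast hU.card_pos
  have hsub : {ω | p * K * √U.card < ‖∑ i ∈ U, score τ (W i ω).2 • (W i ω).1‖} ⊆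
      ⋃ j : Fin p, {ω | K * √U.card < |∑ i ∈ U, score τ (W i ω).2 * (W i ω).1 j|} := by
    intro ω hω
    by_contra hcon
    simp only [Set.mem_iUnion, Set.mem_ofPred_eq, not_exists, not_lt] at hcon hω
    refine absurd (norm_le_of_abs_apply_le (a := K * √U.card) (by positivity) fun j => ?_)
      (not_le.2 (mul_assoc (p : ℝ) K _ ▸ hω))
    simpa using hcon j
  refine (measure_mono hsub).trans ?_
  have hp : (p : ℝ) * η = (Fintype.card (Fin p) : ℕ) * η := by rw [Fintype.card_fin]
  rw [hp]
  refine measure_iUnion_le_card_mul fun j => ?_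
  obtain ⟨hm, hL2, h0, hC⟩ := memLp_score_mul hτ hc₁ hc₄ h_expectile h_moment h_bdd j
  refine (measure_lt_abs_sum_le hW hlaw hind hm hL2 h0 hC (by positivity)).trans
    (ENNReal.ofReal_le_ofReal ?_)
  rw [mul_pow, Real.sq_sqrt hcard.le, mul_comm (K ^ 2), mul_div_mul_left _ _ hcard.ne']
  exact hη

/-- The sample second moment matrix is nondegenerate. -/
lemma measure_not_half_mul_norm_sq_le_le {l δ : ℝ}
    (hl : ∀ v : EuclideanSpace ℝ (Fin p), l * ‖v‖ ^ 2 ≤ v.ofLp ⬝ᵥ (secondMoment π *ᵥ v.ofLp))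
    (hδ0 : 0 < δ) (hδ : (p : ℝ) ^ 2 * δ ≤ l / 2) (h_bdd : ∀ᵐ v ∂π, ‖v‖ < c₄)
    (hW : ∀ i ∈ U, Measurable (W i)) (hlaw : ∀ i ∈ U, P.map (W i) = π ⊗ₘ κ)
    (hind : (U : Set ι).Pairwise fun i j => IndepFun (W i) (W j) P)
    (hU : 0 < U.card) {η : ℝ} (hη : (2 * c₄ ^ 2) ^ 2 / (δ ^ 2 * U.card) ≤ η) :
    P {ω | ¬∀ v : EuclideanSpace ℝ (Fin p),
      l / 2 * U.card * ‖v‖ ^ 2 ≤ ∑ i ∈ U, (inner ℝ (W i ω).1 v) ^ 2} ≤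
      ENNReal.ofReal (p ^ 2 * η) := by
  have hcard : (0 : ℝ) < U.card := by exact_mod_cast hU
  have hsub : {ω | ¬∀ v : EuclideanSpace ℝ (Fin p),
      l / 2 * U.card * ‖v‖ ^ 2 ≤ ∑ i ∈ U, (inner ℝ (W i ω).1 v) ^ 2} ⊆
      ⋃ q : Fin p × Fin p, {ω | δ * U.card <
        |∑ i ∈ U, ((W i ω).1 q.1 * (W i ω).1 q.2 - secondMoment π q.1 q.2)|} := by
    intro ω hω
    by_contra hcon
    simp only [Set.mem_iUnion, Set.mem_ofPred_eq, not_exists, not_lt] at hcon hω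
    exact hω (half_mul_norm_sq_le_sum_inner_sq (x := fun i => (W i ω).1) hl hδ rfl
      fun j k => hcon (j, k))
  refine (measure_mono hsub).trans ?_
  have hq : (p : ℝ) ^ 2 = (Fintype.card (Fin p × Fin p) : ℕ) := by simp [pow_two]
  rw [hq]
  refine measure_iUnion_le_card_mul fun q => ?_
  obtain ⟨hm, hL2, h0, hC⟩ := memLp_mul_sub_secondMoment (κ := κ) h_bdd q.1 q.2
  refine (measure_lt_abs_sum_le hW hlaw hind hm hL2 h0 hC (by positivity)).trans
    (ENNReal.ofReal_le_ofReal (le_trans (le_of_eq ?_) hη))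
  field_simp

/-- The number of small errors in a sample. -/
lemma measure_lt_count_le (hc₃ : 0 ≤ c₃)
    (h_density : ∀ᵐ v ∂π, ∃ f : ℝ → ℝ, Measurable f ∧ (∀ u, 0 < f u ∧ f u ≤ c₃) ∧
      κ v = (volume : Measure ℝ).withDensity (fun u => ENNReal.ofReal (f u)))
    (hW : ∀ i ∈ U, Measurable (W i)) (hlaw : ∀ i ∈ U, P.map (W i) = π ⊗ₘ κ)
    {r q L η : ℝ} (hr : 0 ≤ r) (hq : 0 < q) (hL : 0 < L) (hη : c₃ * (2 * r) / L ≤ η) :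
    P {ω | L * (U.card / q) < ∑ i ∈ U, if |(W i ω).2| ≤ r / q then (1 : ℝ) else 0} ≤
      ENNReal.ofReal η := by
  rcases U.eq_empty_or_nonempty with rfl | hU
  · simp
  have hcard : (0 : ℝ) < U.card := by exact_mod_cast hU.card_pos
  obtain ⟨hm, hle⟩ := measureReal_abs_snd_le (p := p) hc₃ h_density (div_nonneg hr hq.le)
  refine (measure_lt_sum_ite_le hW hlaw hm hle (by positivity)).trans
    (ENNReal.ofReal_le_ofReal (le_trans (le_of_eq ?_) hη))
  field_simp

end sample

end ReER

/-! ### Choice of constants and the union bound -/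

open ReER in
theorem theorem3
    -- dimension, expectile level, batch index
    {p : ℕ} (τ : ℝ) (hτ : τ ∈ Set.Ioo (0 : ℝ) 1) (b : ℕ) (hb : 1 ≤ b)
    (c₁ c₂ c₃ c₄ : ℝ) (hc₁ : 0 < c₁) (hc₂ : 0 < c₂) (hc₃ : 0 < c₃) (hc₄ : 0 < c₄)
    -- law of the covariate, conditional law of the error given the covariate
    (π : Measure (EuclideanSpace ℝ (Fin p))) [IsProbabilityMeasure π]
    (κ : Kernel (EuclideanSpace ℝ (Fin p)) ℝ) [IsMarkovKernel κ]
    -- true parameter in the interior of a compact convex parameter space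
    (β₀ : EuclideanSpace ℝ (Fin p)) (H : Set (EuclideanSpace ℝ (Fin p)))
    (hH_compact : IsCompact H) (hH_convex : Convex ℝ H) (hβ₀ : β₀ ∈ interior H)
    -- conditional expectile zero and bounded conditional second moment of the error
    (h_expectile : ∀ᵐ v ∂π, ReER.IsExpectile τ (κ v) 0)
    (h_moment : ∀ᵐ v ∂π, ∫⁻ u, ENNReal.ofReal (u ^ 2) ∂(κ v) ≤ ENNReal.ofReal c₁)
    -- eigenvalues of the second moment matrix of the covariate
    (h_eig : ∀ μ ∈ spectrum ℝ (ReER.secondMoment π), 0 < μ ∧ μ ≤ c₂)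
    -- positive and bounded conditional density of the error
    (h_density : ∀ᵐ v ∂π, ∃ f : ℝ → ℝ, Measurable f ∧ (∀ u, 0 < f u ∧ f u ≤ c₃) ∧
      κ v = (volume : Measure ℝ).withDensity (fun u => ENNReal.ofReal (f u)))
    -- bounded covariates
    (h_bdd : ∀ᵐ v ∂π, ‖v‖ < c₄)
    -- batch sizes `n k t` at stage `k` of the asymptotics; only the first has to diverge
    (n : ℕ → ℕ → ℕ) (hn : Tendsto (fun k => n k 1) atTop atTop)
    -- i.i.d. observations `(x k t i, y k t i)`, `1 ≤ t ≤ b`, `1 ≤ i ≤ n k t`, at each stage `k`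
    {Ω : Type*} [MeasurableSpace Ω] (P : Measure Ω) [IsProbabilityMeasure P]
    (x : ℕ → ℕ → ℕ → Ω → EuclideanSpace ℝ (Fin p)) (y : ℕ → ℕ → ℕ → Ω → ℝ)
    (hx : ∀ k t i, Measurable (x k t i)) (hy : ∀ k t i, Measurable (y k t i))
    (h_indep : ∀ k, iIndepFun
      (fun (j : {j : ℕ × ℕ // j.1 ∈ Finset.Icc 1 b ∧ j.2 ∈ Finset.Icc 1 (n k j.1)}) (ω : Ω) =>
        (x k j.1.1 j.1.2 ω, y k j.1.1 j.1.2 ω)) P)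
    (h_law : ∀ k, ∀ t ∈ Finset.Icc 1 b, ∀ i ∈ Finset.Icc 1 (n k t),
      P.map (fun ω => (x k t i ω, y k t i ω - inner ℝ (x k t i ω) β₀)) = π ⊗ₘ κ)
    -- renewable estimates `βren k 1, …, βren k b` and oracle estimate `βorc k` at stage `k`
    (βren : ℕ → ℕ → Ω → EuclideanSpace ℝ (Fin p)) (βorc : ℕ → Ω → EuclideanSpace ℝ (Fin p))
    (h_ren : ∀ k, ∀ᵐ ω ∂P, ReER.IsRenewable τ (n k) (fun t i => x k t i ω)
      (fun t i => y k t i ω) b (fun t => βren k t ω))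
    (h_orc : ∀ k, ∀ᵐ ω ∂P, ReER.IsOracle τ (n k) (fun t i => x k t i ω)
      (fun t i => y k t i ω) b (βorc k ω)) :
    ReER.IsBigOp P (fun k ω => ‖βren k b ω - βorc k ω‖)
      (fun k => 1 / (ReER.totalSize (n k) b : ℝ)) := by
  intro ε hε
  have hm := min_pos_of_mem hτ
  obtain ⟨l, hl0, hl⟩ := exists_mul_norm_sq_le_secondMoment fun μ hμ => (h_eig μ hμ).1
  have hb0 : (0 : ℝ) < b := by exact_mod_cast hb
  -- Each of the b batch indices costs pη for the score, p²η for the design and η for the count.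
  obtain ⟨η, hη⟩ : ∃ η : ℝ, η = ε / (b * (p + p ^ 2 + 1)) := ⟨_, rfl⟩
  have hη0 : 0 < η := by rw [hη]; positivity
  obtain ⟨K, hK⟩ : ∃ K : ℝ, K = √(c₄ ^ 2 * c₁ / η) := ⟨_, rfl⟩
  have hK0 : 0 < K := by rw [hK]; positivity
  have hKη : c₄ ^ 2 * c₁ / K ^ 2 ≤ η := by
    rw [hK, Real.sq_sqrt (by positivity)]
    exact le_of_eq (by field_simp)
  obtain ⟨δ, hδ⟩ : ∃ δ : ℝ, δ = l / (2 * (p ^ 2 + 1)) := ⟨_, rfl⟩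
  have hδ0 : 0 < δ := by rw [hδ]; positivity
  have hδl : (p : ℝ) ^ 2 * δ ≤ l / 2 := by
    rw [hδ, ← mul_div_assoc, div_le_div_iff₀ (by positivity) two_pos]
    nlinarith
  have hrc : ∀ t ∈ Finset.Icc 1 b, 0 ≤ rateConst c₄ (p * K) (min τ (1 - τ) * (l / 2)) t :=
    fun t _ => rateConst_nonneg (by positivity) (by positivity) t
  -- The sum dominates each rate constant and the 1 makes R positive. R depends on K but not on L,
  -- so the count threshold can be chosen afterwards.
  obtain ⟨R, hR⟩ : ∃ R : ℝ,
      R = ∑ t ∈ Finset.Icc 1 b, rateConst c₄ (p * K) (min τ (1 - τ) * (l / 2)) t + 1 := ⟨_, rfl⟩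
  have hR0 : 0 < R := by
    rw [hR]
    have := Finset.sum_nonneg hrc
    positivity
  have hRle : ∀ t ∈ Finset.Icc 1 b, rateConst c₄ (p * K) (min τ (1 - τ) * (l / 2)) t ≤ R :=
    fun t ht => by
      rw [hR]
      linarith [Finset.single_le_sum hrc ht]
  obtain ⟨L, hL⟩ : ∃ L : ℝ, L = c₃ * (2 * (c₄ * R)) / η := ⟨_, rfl⟩
  have hL0 : 0 < L := by rw [hL]; positivity
  have hLη : c₃ * (2 * (c₄ * R)) / L ≤ η := by
    rw [hL]
    exact le_of_eq (by field_simp)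
  refine ⟨b * (b * (4 * c₄ ^ 2 * R * L)) / (min τ (1 - τ) * (l / 2)), by positivity, ?_⟩
  -- The threshold on n_1 brings Chebyshev's bound for each entry of the pooled second moments below
  -- η, since N_t ≥ n_1.
  filter_upwards [hn.eventually_ge_atTop (⌈(2 * c₄ ^ 2) ^ 2 / (δ ^ 2 * η)⌉₊ + 1)] with k hk
  have hn1 : 0 < n k 1 := by omega
  have hnη : (2 * c₄ ^ 2) ^ 2 / (δ ^ 2 * η) ≤ n k 1 :=
    (Nat.le_ceil _).trans (by exact_mod_cast (Nat.le_succ _).trans hk)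
  -- the sample of covariates and errors at stage `k`
  obtain ⟨W, hWdef⟩ : ∃ W : ℕ → ℕ → Ω → EuclideanSpace ℝ (Fin p) × ℝ,
      W = fun t i ω => (x k t i ω, y k t i ω - inner ℝ (x k t i ω) β₀) := ⟨_, rfl⟩
  have hφ : Measurable fun z : EuclideanSpace ℝ (Fin p) × ℝ => (z.1, z.2 - inner ℝ z.1 β₀) := by
    fun_prop
  have hW : ∀ t i, Measurable (W t i) := fun t i => by
    rw [hWdef]
    exact hφ.comp ((hx k t i).prodMk (hy k t i))
  have hlaw : ∀ t ∈ Finset.Icc 1 b, ∀ i ∈ Finset.Icc 1 (n k t), P.map (W t i) = π ⊗ₘ κ := by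
    rw [hWdef]
    exact h_law k
  have hind : ∀ s ∈ Finset.Icc 1 b, ∀ i ∈ Finset.Icc 1 (n k s), ∀ t ∈ Finset.Icc 1 b,
      ∀ j ∈ Finset.Icc 1 (n k t), (s, i) ≠ (t, j) → IndepFun (W s i) (W t j) P := by
    intro s hs i hi t ht j hj hne
    have := (h_indep k).indepFun (i := ⟨(s, i), hs, hi⟩) (j := ⟨(t, j), ht, hj⟩)
      (fun h => hne (congrArg Subtype.val h))
    rw [hWdef]
    exact this.comp hφ hφ
  -- the exceptional events
  obtain ⟨A, hA⟩ : ∃ A : ℕ → Set Ω, A = fun t => {ω | p * K * √(Finset.Icc 1 (n k t)).card <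
      ‖∑ i ∈ Finset.Icc 1 (n k t), score τ (W t i ω).2 • (W t i ω).1‖} := ⟨_, rfl⟩
  -- Batches 1 to t are pooled because a later batch alone may be too small for a nondegenerate
  -- design.
  obtain ⟨U, hU⟩ : ∃ U : ℕ → Finset (Σ _ : ℕ, ℕ),
      U = fun t => (Finset.Icc 1 t).sigma fun s => Finset.Icc 1 (n k s) := ⟨_, rfl⟩
  have hUcard : ∀ t, (U t).card = totalSize (n k) t := fun t => by
    rw [hU, Finset.card_sigma]
    simp [totalSize]
  obtain ⟨B, hB⟩ : ∃ B : ℕ → Set Ω, B = fun t => {ω | ¬∀ v : EuclideanSpace ℝ (Fin p),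
      l / 2 * (U t).card * ‖v‖ ^ 2 ≤ ∑ q ∈ U t, (inner ℝ (W q.1 q.2 ω).1 v) ^ 2} := ⟨_, rfl⟩
  obtain ⟨C, hC⟩ : ∃ C : ℕ → Set Ω, C = fun t =>
      {ω | L * ((Finset.Icc 1 (n k t)).card / √(totalSize (n k) t)) <
        ∑ i ∈ Finset.Icc 1 (n k t),
          if |(W t i ω).2| ≤ c₄ * R / √(totalSize (n k) t) then (1 : ℝ) else 0} := ⟨_, rfl⟩
  have hN : ∀ t ∈ Finset.Icc 1 b, n k 1 ≤ totalSize (n k) t := fun t ht =>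
    le_totalSize _ le_rfl (Finset.mem_Icc.1 ht).1
  have hPA : ∀ t ∈ Finset.Icc 1 b, P (A t) ≤ ENNReal.ofReal (p * η) := fun t ht => by
    rw [hA]
    exact measure_lt_norm_sum_score_le hτ hc₁.le hc₄.le h_expectile h_moment h_bdd
      (fun i _ => hW t i) (hlaw t ht)
      (fun i hi j hj hij => hind t ht i hi t ht j hj fun h => hij (congrArg Prod.snd h)) hK0 hKη
  have hPB : ∀ t ∈ Finset.Icc 1 b, P (B t) ≤ ENNReal.ofReal (p ^ 2 * η) := fun t ht => by
    have hmem : ∀ q ∈ U t, q.1 ∈ Finset.Icc 1 b ∧ q.2 ∈ Finset.Icc 1 (n k q.1) := fun q hq => by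
      rw [hU, Finset.mem_sigma] at hq
      exact ⟨Finset.Icc_subset_Icc_right (Finset.mem_Icc.1 ht).2 hq.1, hq.2⟩
    have hNt : (n k 1 : ℝ) ≤ (U t).card := by
      rw [hUcard]
      exact_mod_cast hN t ht
    have hNt0 : 0 < (U t).card := by
      rw [hUcard]
      exact hn1.trans_le (hN t ht)
    rw [hB]
    refine measure_not_half_mul_norm_sq_le_le (W := fun q : Σ _ : ℕ, ℕ => W q.1 q.2) hl hδ0 hδl
      h_bdd (fun q _ => hW q.1 q.2)
      (fun q hq => hlaw _ (hmem q hq).1 _ (hmem q hq).2) (fun q hq q' hq' hne =>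
        hind _ (hmem q hq).1 _ (hmem q hq).2 _ (hmem q' hq').1 _ (hmem q' hq').2 fun h => hne ?_)
      hNt0 ?_
    · obtain ⟨h1, h2⟩ := Prod.mk.inj h
      exact Sigma.ext h1 (heq_of_eq h2)
    · have h1 := hnη.trans hNt
      rw [div_le_iff₀ (by positivity)] at h1
      rw [div_le_iff₀ (by positivity)]
      linarith
  have hPC : ∀ t ∈ Finset.Icc 1 b, P (C t) ≤ ENNReal.ofReal η := fun t ht => by
    have hNt : (0 : ℝ) < totalSize (n k) t := by exact_mod_cast hn1.trans_le (hN t ht)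
    rw [hC]
    exact measure_lt_count_le hc₃.le h_density (fun i _ => hW t i) (hlaw t ht) (by positivity)
      (Real.sqrt_pos.2 hNt) hL0 hLη
  have hbdd : ∀ᵐ ω ∂P, ∀ t i, t ∈ Finset.Icc 1 b → i ∈ Finset.Icc 1 (n k t) →
      ‖(W t i ω).1‖ < c₄ := by
    rw [ae_all_iff]
    intro t
    rw [ae_all_iff]
    intro i
    by_cases h : t ∈ Finset.Icc 1 b ∧ i ∈ Finset.Icc 1 (n k t)
    · have h1 := ae_compProd_norm_fst_lt (κ := κ) h_bdd
      rw [← hlaw t h.1 i h.2] at h1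
      exact (ae_of_ae_map (hW t i).aemeasurable h1).mono fun ω hω _ _ => hω
    · exact Eventually.of_forall fun ω h1 h2 => absurd ⟨h1, h2⟩ h
  have hgood : ∀ᵐ ω ∂P, ω ∉ ⋃ t ∈ Finset.Icc 1 b, (A t ∪ B t ∪ C t) →
      ‖βren k b ω - βorc k ω‖ ≤ b * (b * (4 * c₄ ^ 2 * R * L)) / (min τ (1 - τ) * (l / 2)) *
        (1 / totalSize (n k) b) := by
    filter_upwards [h_ren k, h_orc k, hbdd] with ω hren horc hx' hω
    simp only [hA, hB, hC, Set.mem_iUnion, Set.mem_union, Set.mem_ofPred_eq, not_exists, not_or,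
      not_lt, not_not, hUcard, Nat.card_Icc, Nat.add_sub_cancel] at hω
    rw [hWdef] at hω hx'
    refine hren.norm_sub_oracle_le hτ hb hn1 horc hc₄.le (half_pos hl0) (K := p * K) (β₀ := β₀)
      (by positivity) (fun s hs i hi => (hx' s i hs hi).le) (fun t ht => ?_) (fun t ht v => ?_)
      hL0.le hRle (fun t ht => (hω t ht).2)
    · rw [batchGrad, norm_neg]
      exact (hω t ht).1.1
    · have := (hω t ht).1.2 v
      rw [hU, Finset.sum_sigma] at this
      exact this
  have hbad : P (⋃ t ∈ Finset.Icc 1 b, (A t ∪ B t ∪ C t)) ≤ ENNReal.ofReal ε := by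
    have h1 : ∀ t ∈ Finset.Icc 1 b, P (A t ∪ B t ∪ C t) ≤
        ENNReal.ofReal ((p + p ^ 2 + 1) * η) := fun t ht => by
      refine (measure_union_le _ _).trans ((add_le_add ((measure_union_le _ _).trans
        (add_le_add (hPA t ht) (hPB t ht))) (hPC t ht)).trans (le_of_eq ?_))
      rw [← ENNReal.ofReal_add (by positivity) (by positivity),
        ← ENNReal.ofReal_add (by positivity) (by positivity)]
      congr 1
      ring
    refine (measure_biUnion_finset_le _ _).trans ((Finset.sum_le_sum h1).trans (le_of_eq ?_))
    rw [Finset.sum_const, nsmul_eq_mul, Nat.card_Icc, Nat.add_sub_cancel, ← ENNReal.ofReal_natCast,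
      ← ENNReal.ofReal_mul (Nat.cast_nonneg _), hη]
    congr 1
    field_simp
  rw [ae_iff] at hgood
  refine (measure_mono fun ω hω => ?_).trans ((measure_union_le _ _).trans
    ((add_le_add hbad hgood.le).trans (add_zero _).le))
  by_contra hcon
  simp only [Set.mem_union, Set.mem_ofPred_eq, not_or, not_not] at hcon hω
  rw [abs_of_nonneg (norm_nonneg _)] at hω
  exact absurd (hcon.2 hcon.1) (not_le.2 hω)
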